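/- **Setting.** There are $m$ resources and $n$ products; $A=(a_{ij})\in\mathbb N^{m\times n}$ is the consumption matrix with columns $A^j$, $p\in\mathbb R^n$ the prices, $c\in\mathbb N^m$ the initial inventory, $T>0$ the horizon, $\gamma\ge 0$ the temperature. Let $\mathcal X=\{x\in\mathbb N^m: x\le c\}$, let $\mathcal A$ be the set of all subsets of $\{1,\dots,n\}$, and $\mathcal A(x)=\{S\in\mathcal A: A^j\le x \text{ for all } j\in S\}$. Customers arrive according to a Poisson process of rate $\lambda>0$. A customer who is offered the assortment $S$ buys product $j$ with probability $P_j(S)$ and nothing with probability $P_0(S)$, where $P_j(S)\ge 0$, $P_j(S)=0$ for $j\notin S$, $j\ne 0$, and $\sum_{j=0}^n P_j(S)=1$. An admissible policy is a map $\pi:[0,T]\times\mathcal X\times\mathcal A\to[0,1]$, written $\pi(S\mid t,x)$, such that $\pi(\cdot\mid t,x)$ is a probability distribution on $\mathcal A$ that vanishes outside $\mathcal A(x)$ and $t\mapsto\pi(S\mid t,x)$ is continuous on $[0,T]$. Under $\pi$, a customer who arrives at time $t\le T$ is offered an assortment $S_t$ drawn from $\pi(\cdot\mid t,X_{t-})$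 and then chooses from it, the draws and choices being made with i.i.d. uniform variables independent of the arrivals. $N_{j,t}$ counts the sales of product $j$, and $X_t$ is the remaining inventory, which drops by $A^j$ at each sale of $j$. With $\mathcal H(\pi(\cdot\mid t,x))=-\sum_{S\in\mathcal A(x)}\pi(S\mid t,x)\log\pi(S\mid t,x)$ (and $0\log0=0$), the value function is $$J(t,x;\pi)=\mathbb E\Big[\int_{(t,T]}\sum_{j=1}^n p_j\,dN_{j,s}+\gamma\int_t^T\mathcal H(\pi(\cdot\mid s,X_{s-}))\,ds\;\Big|\;X_t=x\Big],$$ the expectation being for the system started at time $t$ with inventory $x$. **Theorem.** Let $\Phi\subseteq\mathbb R^d$ be open and let $\{\pi^\phi:\phi\in\Phi\}$ be a family of admissible policies such that (a) $\phi\mapsto\pi^\phi(S\mid t,x)$ is $C^\infty$ on $\Phi$ for all $t\in[0,T]$, $x\in\mathcal X$, $S\in\mathcal A$; (b) $t\mapsto\nabla_\phi\pi^\phi(S\mid t,x)$ is continuous on $[0,T]$ for all $x,S,\phi$; (c) for every compact $K\subset\Phi$ the second derivatives $\nabla^2_\phi\pi^\phi(S\mid t,x)$ are bounded over $\phi\in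 K$, $t\in[0,T]$, $x\in\mathcal X$, $S\in\mathcal A$. Then, for every $\phi\in\Phi$, the function $J(0,c;\pi^{\cdot})$ is differentiable at $\phi$, the random variable inside the expectation below is integrable, and $$\nabla_\phi J(0,c;\pi^\phi)=\mathbb E\Big[\int_{(0,T]}\sum_{j=1}^n\nabla_\phi\log\pi^\phi(S_t\mid t,X_{t-})\,\big[J(t,X_{t-}-A^j;\pi^\phi)-J(t,X_{t-};\pi^\phi)+p_j\big]\,dN_{j,t}+\gamma\int_0^T\nabla_\phi\mathcal H(\pi^\phi(\cdot\mid t,X_{t-}))\,dt\;\Big|\;X_0=c\Big],$$ where $X$, $S$, $N$ are the processes under $\pi^\phi$. -/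

import Mathlib

open MeasureTheory

noncomputable section

/-- Inventory vectors of `m` resources. -/
abbrev Inventory (m : ℕ) : Type := Fin m → ℕ

/-- Assortments: subsets of the `n` products. -/
abbrev Assortment (n : ℕ) : Type := Finset (Fin n)

/-- The data of a policy, `π t x S` being the probability of offering `S` at time `t` in the
inventory state `x`. Only the values at `t ∈ [0,T]`, `0 ≤ x ≤ c` are ever relevant. -/
abbrev Policy (m n : ℕ) : Type := ℝ → Inventory m → Assortment n → ℝ

/-- What one arriving customer brings along: the time elapsed since the previous arrival, the uniform
variable with which the firm draws the assortment, and the uniform variable which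
determines the choice of the customer. -/
abbrev Customer : Type := ℝ × ℝ × ℝ

/-- A network revenue management problem with `m` resources and `n` products. -/
structure RevenueNetwork (m n : ℕ) where
  /-- consumption matrix -/
  A : Matrix (Fin m) (Fin n) ℕ
  /-- prices -/
  p : Fin n → ℝ
  /-- initial inventory -/
  c : Inventory m
  /-- length of the selling horizon -/
  T : ℝ
  /-- arrival rate of the customers -/
  rate : ℝ
  /-- temperature -/
  γ : ℝ
  /-- choice probabilities; `none` is the no-purchase option -/
  P : Assortment n → Option (Fin n) → ℝ
  T_pos : 0 < T
  rate_pos : 0 < rate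
  γ_nonneg : 0 ≤ γ
  P_nonneg : ∀ S o, 0 ≤ P S o
  P_eq_zero : ∀ S j, j ∉ S → P S (some j) = 0
  P_sum : ∀ S, ∑ o, P S o = 1

/-- Inverse-transform sampling from the weights `q` along a list: the `i`-th entry `a` is
returned exactly when `0 ≤ u - (sum of the weights of the earlier entries) < q a`, for `u ≥ 0`. -/
def sampleList {α : Type*} (q : α → ℝ) : List α → ℝ → Option α
  | [], _ => none
  | a :: l, u => if u < q a then some a else sampleList q l (u - q a)

/-- If `q` is a probability distribution on the finite type `α` and `u` is uniform on `[0,1]`,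
then `sample q u` has distribution `q`; the default value is needed for `u = 1` only. -/
def sample {α : Type*} [Fintype α] [Inhabited α] (q : α → ℝ) (u : ℝ) : α :=
  (sampleList q Finset.univ.toList u).getD default

namespace RevenueNetwork

variable {m n : ℕ} (M : RevenueNetwork m n)

/-- `𝒜(x)`: the assortments all of whose products can be served from the inventory `x`. -/
def available (x : Inventory m) : Finset (Assortment n) :=
  Finset.univ.filter fun S => ∀ j ∈ S, ∀ i, M.A i j ≤ x i

/-- Admissible randomized Markov policies. -/
structure IsAdmissible (π : Policy m n) : Prop where
  measurable : ∀ x ≤ M.c, ∀ S, Measurable fun t : Set.Icc 0 M.T => π t x S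
  nonneg : ∀ t ∈ Set.Icc 0 M.T, ∀ x ≤ M.c, ∀ S, 0 ≤ π t x S
  sum_eq_one : ∀ t ∈ Set.Icc 0 M.T, ∀ x ≤ M.c, ∑ S, π t x S = 1
  available : ∀ t ∈ Set.Icc 0 M.T, ∀ x ≤ M.c, ∀ S, S ∉ M.available x → π t x S = 0
  continuousOn : ∀ x ≤ M.c, ∀ S, ContinuousOn (fun t => π t x S) (Set.Icc 0 M.T)

/-- Entropy of `π(· ∣ t, x)`, with `0 log 0 = 0`. -/
def entropy (π : Policy m n) (t : ℝ) (x : Inventory m) : ℝ :=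
  -∑ S ∈ M.available x, π t x S * Real.log (π t x S)

/-- Law of the data of one customer: an exponential inter-arrival time of rate `λ` and
two uniform variables on `[0,1]`, all independent. -/
def customerLaw : Measure Customer :=
  (ProbabilityTheory.expMeasure M.rate).prod
    ((volume.restrict (Set.Icc (0 : ℝ) 1)).prod (volume.restrict (Set.Icc (0 : ℝ) 1)))

instance isProbabilityMeasure_customerLaw : IsProbabilityMeasure M.customerLaw := by
  have h1 : IsProbabilityMeasure (ProbabilityTheory.expMeasure M.rate) :=
    ProbabilityTheory.isProbabilityMeasure_expMeasure M.rate_pos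
  have h2 : IsProbabilityMeasure (volume.restrict (Set.Icc (0 : ℝ) 1)) := ⟨by simp⟩
  unfold customerLaw
  infer_instance

/-- The underlying probability measure: an i.i.d. sequence of customers. The arrival times form a
Poisson process of rate `λ`, independent of the i.i.d. uniform variables. -/
def prob : Measure (ℕ → Customer) :=
  Measure.infinitePi fun _ => M.customerLaw

/-- Arrival time of the `k`-th customer (`k = 0, 1, …`) after time `t`. -/
def arrival (t : ℝ) (ω : ℕ → Customer) (k : ℕ) : ℝ :=
  t + ∑ i ∈ Finset.range (k + 1), (ω i).1

/-- The purchase of a customer with data `z` who arrives at time `s` in the inventory state `x`: an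
assortment is drawn from `π(· ∣ s, x)`, and the customer chooses from it. There are no
sales after the horizon `T`. -/
def purchase (π : Policy m n) (s : ℝ) (x : Inventory m) (z : Customer) : Option (Fin n) :=
  if s ≤ M.T then sample (M.P (sample (π s x) z.2.1)) z.2.2 else none

/-- `x - A^j`. Sales of `j` occur only if `A^j ≤ x`, so that there the subtraction of natural
numbers does not truncate. -/
def deplete (x : Inventory m) (j : Fin n) : Inventory m := fun i => x i - M.A i j

/-- The inventory after the first `k` customers, for the system started at time `t` with
inventory `x` and run under `π`. -/
def stateAfter (π : Policy m n) (t : ℝ) (x : Inventory m) (ω : ℕ → Customer) : ℕ → Inventory m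
  | 0 => x
  | k + 1 =>
    match M.purchase π (arrival t ω k) (stateAfter π t x ω k) (ω k) with
    | none => stateAfter π t x ω k
    | some j => M.deplete (stateAfter π t x ω k) j

/-- The purchase of the `k`-th customer. -/
def sale (π : Policy m n) (t : ℝ) (x : Inventory m) (ω : ℕ → Customer) (k : ℕ) :
    Option (Fin n) :=
  M.purchase π (arrival t ω k) (M.stateAfter π t x ω k) (ω k)

/-- Number of customers who arrive after `t` and strictly before `s`. -/
def countBefore (t : ℝ) (ω : ℕ → Customer) (s : ℝ) : ℕ :=
  Set.ncard {k : ℕ | arrival t ω k < s}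

/-- `X_{s-}`: the inventory immediately before time `s`. -/
def stateLeft (π : Policy m n) (t : ℝ) (x : Inventory m) (ω : ℕ → Customer) (s : ℝ) :
    Inventory m :=
  M.stateAfter π t x ω (countBefore t ω s)

/-- `S_s`: the assortment on offer at time `s`, drawn from `π(· ∣ s, X_{s-})` with the uniform
variable of the next customer. At an arrival time it is the assortment
that the arriving customer is offered. -/
def offered (π : Policy m n) (t : ℝ) (x : Inventory m) (ω : ℕ → Customer) (s : ℝ) :
    Assortment n :=
  sample (π s (M.stateLeft π t x ω s)) (ω (countBefore t ω s)).2.1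

/-- `dN_j`: the counting measure on the times at which product `j` is sold, so that
`N_{j,s}` is the mass of `(t, s]`. -/
def saleMeasure (π : Policy m n) (t : ℝ) (x : Inventory m) (ω : ℕ → Customer) (j : Fin n) :
    Measure ℝ :=
  Measure.sum fun k : ℕ =>
    if M.sale π t x ω k = some j then Measure.dirac (arrival t ω k) else 0

/-- Entropy-regularized revenue collected in `(t, T]` along one trajectory started at `(t, x)`. -/
def payoff (π : Policy m n) (t : ℝ) (x : Inventory m) (ω : ℕ → Customer) : ℝ :=
  (∑ j, ∫ _s in Set.Ioc t M.T, M.p j ∂(M.saleMeasure π t x ω j))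
    + M.γ * ∫ s in t..M.T, M.entropy π s (M.stateLeft π t x ω s)

/-- The value function `J(t, x; π)`. -/
def J (π : Policy m n) (t : ℝ) (x : Inventory m) : ℝ :=
  ∫ ω, M.payoff π t x ω ∂M.prob

/-- Smoothness of a parametrized policy on the parameter set `Φ`. -/
structure IsSmoothFamily {d : ℕ} (Φ : Set (EuclideanSpace ℝ (Fin d)))
    (π : EuclideanSpace ℝ (Fin d) → Policy m n) : Prop where
  smooth : ∀ t ∈ Set.Icc 0 M.T, ∀ x ≤ M.c, ∀ S, ContDiffOn ℝ (⊤ : ℕ∞) (fun φ => π φ t x S) Φ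
  gradient_continuousOn : ∀ φ ∈ Φ, ∀ x ≤ M.c, ∀ S,
    ContinuousOn (fun t => gradient (fun ψ => π ψ t x S) φ) (Set.Icc 0 M.T)
  /-- the Hessians are bounded uniformly in time, locally uniformly in the parameter -/
  hessian_bounded : ∀ K ⊆ Φ, IsCompact K → ∃ C : ℝ, ∀ φ ∈ K, ∀ t ∈ Set.Icc 0 M.T,
    ∀ x ≤ M.c, ∀ S, ‖iteratedFDeriv ℝ 2 (fun ψ => π ψ t x S) φ‖ ≤ C

/-- The random variable inside the expectation of the policy gradient formula, for
the system started at time `0` with inventory `c` and run under `π φ`. -/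
def gradientSample {d : ℕ} (π : EuclideanSpace ℝ (Fin d) → Policy m n)
    (φ : EuclideanSpace ℝ (Fin d)) (ω : ℕ → Customer) : EuclideanSpace ℝ (Fin d) :=
  (∑ j, ∫ s in Set.Ioc 0 M.T,
      (M.J (π φ) s (M.deplete (M.stateLeft (π φ) 0 M.c ω s) j)
          - M.J (π φ) s (M.stateLeft (π φ) 0 M.c ω s) + M.p j) •
        gradient (fun ψ => Real.log
          (π ψ s (M.stateLeft (π φ) 0 M.c ω s) (M.offered (π φ) 0 M.c ω s))) φ
      ∂(M.saleMeasure (π φ) 0 M.c ω j))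
    + M.γ • ∫ s in (0 : ℝ)..M.T,
        gradient (fun ψ => M.entropy (π ψ) s (M.stateLeft (π φ) 0 M.c ω s)) φ

end RevenueNetwork

end

/-!
The sequence (arrival time, inventory just after the customer) is a Markov chain driven by the
i.i.d. customers, and both the payoff and the gradient sample are sums, over the customers, of
rewards collected between a customer and the next one (`IsGood.rewards_eq_chainTotal`). Under the
weight `exp (-rate * t)`, whose mean is halved by each customer, such sums are integrable and their
means satisfy a renewal equation obtained by conditioning on the first customer
(`integral_chainTotal_eq`, `IsBoundedReward.value_eq`). The same weight shows that the arrival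
times tend to infinity almost surely.

For the value function the renewal equation reads `J = b + K J`, where `b` and the contraction `K`
are affine in the policy and its entropy. For the mean `G` of the gradient sample, the score
`∇ log π` of the offered assortment is averaged with the weights `π`, hence turns into `∇ π`; as
`∑ S, ∇ π S = 0`, the value before the sale drops out, and `G` satisfies the equation
`G = ∇b + (∇K) J + K G` which results from formal differentiation
(`IsRegularFamilyAt.sum_gradientSale`, `IsRegularFamilyAt.gradientValue_eq`). Therefore the
remainder `e = J^ψ - J^φ - ⟪G, ψ - φ⟫` satisfies `e = source + K^ψ e`, and the contraction bounds
`e` by twice the source (`abs_le_of_contraction`), which is `o(‖ψ - φ‖)`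
(`IsRegularFamilyAt.exists_abs_J_sub_sub_inner_le`).

The estimates of the source rest on Glaeser's inequality `‖∇f‖ ≤ L √f` for nonnegative functions
with bounded second derivative (`norm_fderiv_le_sqrt`). It makes `-π log π` differentiable, also
where `π` vanishes, and Lipschitz in the parameter uniformly in time, so that the remainder of the
entropy can be treated by dominated convergence; the second order bound on `π` itself is Taylor's
formula.

A policy is controlled for times in `[0, T]` and inventories `≤ c` only. It is replaced at the
outset by a policy which offers nothing elsewhere (`confine`); this changes neither the
value function nor the gradient sample, up to null sets, and makes all estimates global.
-/

noncomputable section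

open scoped ENNReal

/-! ### Additive functionals of a Markov chain driven by i.i.d. noise -/

section Chain

variable {Y Z E : Type*}

/-- The trajectory started at `y` of the recursion `Y (k + 1) = Ψ (Y k) (ω k)` driven by the
noise `ω`. -/
def chain (Ψ : Y → Z → Y) (y : Y) (ω : ℕ → Z) : ℕ → Y
  | 0 => y
  | k + 1 => Ψ (chain Ψ y ω k) (ω k)

/-- Prepend an element to a sequence. -/
def seqCons (z : Z) (ω : ℕ → Z) : ℕ → Z
  | 0 => z
  | k + 1 => ω k

lemma chain_seqCons_succ (Ψ : Y → Z → Y) (y : Y) (z : Z) (ω : ℕ → Z) (k : ℕ) :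
    chain Ψ y (seqCons z ω) (k + 1) = chain Ψ (Ψ y z) ω k := by
  induction k with
  | zero => rfl
  | succ k ih => rw [chain, ih]; rfl

variable [MeasurableSpace Y] [MeasurableSpace Z]

lemma measurable_chain {Ψ : Y → Z → Y} (hΨ : Measurable fun p : Y × Z => Ψ p.1 p.2) (k : ℕ) :
    Measurable fun p : Y × (ℕ → Z) => chain Ψ p.1 p.2 k := by
  induction k with
  | zero => exact measurable_fst
  | succ k ih => exact hΨ.comp (ih.prodMk ((measurable_pi_apply k).comp measurable_snd))

lemma measurable_seqCons : Measurable fun p : Z × (ℕ → Z) => seqCons p.1 p.2 := by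
  refine measurable_pi_iff.2 fun k => ?_
  cases k with
  | zero => exact measurable_fst
  | succ k => exact (measurable_pi_apply k).comp measurable_snd

variable (μ : Measure Z) [IsProbabilityMeasure μ]

/-- An i.i.d. sequence is an independent first entry followed by an i.i.d. sequence. -/
lemma measurePreserving_seqCons :
    MeasurePreserving (fun p : Z × (ℕ → Z) => seqCons p.1 p.2)
      (μ.prod (Measure.infinitePi fun _ => μ)) (Measure.infinitePi fun _ => μ) := by
  refine ⟨measurable_seqCons, Measure.eq_infinitePi _ fun s t ht => ?_⟩
  rw [Measure.map_apply measurable_seqCons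
    (MeasurableSet.pi s.countable_toSet fun i _ => ht i)]
  have key : (fun p : Z × (ℕ → Z) => seqCons p.1 p.2) ⁻¹' ((s : Set ℕ).pi t)
      = (if 0 ∈ s then t 0 else Set.univ) ×ˢ
        (((s.filter (· ≠ 0)).image Nat.pred : Finset ℕ) : Set ℕ).pi fun k => t (k + 1) := by
    ext ⟨z, ω⟩
    simp only [Set.mem_preimage, Set.mem_pi, Finset.mem_coe, Set.mem_prod, Finset.mem_image,
      Finset.mem_filter]
    constructor
    · intro h
      refine ⟨?_, ?_⟩
      · split_ifs with h0
        · exact h 0 h0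
        · trivial
      · rintro k ⟨i, ⟨hi, hi0⟩, rfl⟩
        obtain ⟨j, rfl⟩ := Nat.exists_eq_succ_of_ne_zero hi0
        exact h _ hi
    · rintro ⟨h0, h1⟩ i hi
      cases i with
      | zero => rwa [if_pos hi] at h0
      | succ j => exact h1 j ⟨j + 1, ⟨hi, by simp⟩, rfl⟩
  rw [key, Measure.prod_prod, Measure.infinitePi_pi _ (fun i _ => ht (i + 1)),
    Finset.prod_image]
  · by_cases h0 : 0 ∈ s
    · rw [if_pos h0, ← Finset.mul_prod_erase s _ h0]
      congr 1
      have : s.erase 0 = s.filter (· ≠ 0) := by ext; simp [and_comm]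
      rw [this]
      refine Finset.prod_congr rfl fun i hi => ?_
      obtain ⟨j, rfl⟩ := Nat.exists_eq_succ_of_ne_zero (Finset.mem_filter.1 hi).2
      rfl
    · rw [if_neg h0, measure_univ, one_mul]
      have : s.filter (· ≠ 0) = s :=
        Finset.filter_true_of_mem fun i hi h => h0 (h ▸ hi)
      rw [this]
      refine Finset.prod_congr rfl fun i hi => ?_
      obtain ⟨j, rfl⟩ := Nat.exists_eq_succ_of_ne_zero (show i ≠ 0 from fun h => h0 (h ▸ hi))
      rfl
  · intro i hi j hj hij
    simp only [Finset.coe_filter, Set.mem_ofPred_eq] at hi hj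
    have := hi.2; have := hj.2
    simp only [Nat.pred_eq_sub_one] at hij
    omega

lemma lintegral_seqCons {f : (ℕ → Z) → ℝ≥0∞} (hf : Measurable f) :
    ∫⁻ ω, f ω ∂(Measure.infinitePi fun _ => μ)
      = ∫⁻ z, ∫⁻ ω, f (seqCons z ω) ∂(Measure.infinitePi fun _ => μ) ∂μ := by
  rw [← (measurePreserving_seqCons μ).lintegral_comp hf]
  exact lintegral_prod _ (hf.comp measurable_seqCons).aemeasurable

/-- If `w` is halved in the mean by each step, then its mean along the chain decays
geometrically. -/
lemma lintegral_chain_le {Ψ : Y → Z → Y} (hΨ : Measurable fun p : Y × Z => Ψ p.1 p.2)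
    {w : Y → ℝ≥0∞} (hw : ∀ y, ∫⁻ z, w (Ψ y z) ∂μ ≤ 2⁻¹ * w y)
    {r : Y → Z → ℝ≥0∞} (hr : Measurable fun p : Y × Z => r p.1 p.2) {C : ℝ≥0∞} (hC : C ≠ ⊤)
    (hrw : ∀ y, ∫⁻ z, r y z ∂μ ≤ C * w y) (y : Y) (k : ℕ) :
    ∫⁻ ω, r (chain Ψ y ω k) (ω k) ∂(Measure.infinitePi fun _ => μ) ≤ C * 2⁻¹ ^ k * w y := by
  have hmeas : ∀ k y, Measurable fun ω : ℕ → Z => r (chain Ψ y ω k) (ω k) := fun k y =>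
    hr.comp (((measurable_chain hΨ k).comp measurable_prodMk_left).prodMk (measurable_pi_apply k))
  induction k generalizing y with
  | zero =>
    rw [lintegral_seqCons μ (hmeas 0 y)]
    simpa [chain, seqCons] using hrw y
  | succ k ih =>
    rw [lintegral_seqCons μ (hmeas (k + 1) y)]
    calc ∫⁻ z, ∫⁻ ω, r (chain Ψ y (seqCons z ω) (k + 1)) (seqCons z ω (k + 1))
          ∂(Measure.infinitePi fun _ => μ) ∂μ
        ≤ ∫⁻ z, C * 2⁻¹ ^ k * w (Ψ y z) ∂μ := by
          refine lintegral_mono fun z => ?_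
          simp only [chain_seqCons_succ, seqCons]
          exact ih (Ψ y z)
      _ = C * 2⁻¹ ^ k * ∫⁻ z, w (Ψ y z) ∂μ :=
          lintegral_const_mul' _ _ (ENNReal.mul_ne_top hC (by simp))
      _ ≤ C * 2⁻¹ ^ k * (2⁻¹ * w y) := by gcongr; exact hw y
      _ = C * 2⁻¹ ^ (k + 1) * w y := by ring

variable [NormedAddCommGroup E]

/-- The sum of the rewards `R` collected along the chain. -/
def chainTotal (Ψ : Y → Z → Y) (R : Y → Z → E) (y : Y) (ω : ℕ → Z) : E :=
  ∑' k, R (chain Ψ y ω k) (ω k)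

variable {Ψ : Y → Z → Y} (hΨ : Measurable fun p : Y × Z => Ψ p.1 p.2)
  {w : Y → ℝ≥0∞} (hwtop : ∀ y, w y ≠ ⊤)
  (hw : ∀ y, ∫⁻ z, w (Ψ y z) ∂μ ≤ 2⁻¹ * w y)
  {R : Y → Z → E} (hR : StronglyMeasurable fun p : Y × Z => R p.1 p.2) {C : ℝ≥0∞} (hC : C ≠ ⊤)
  (hRw : ∀ y, ∫⁻ z, ‖R y z‖ₑ ∂μ ≤ C * w y)

include hΨ hR in
lemma stronglyMeasurable_chain_reward (k : ℕ) :
    StronglyMeasurable fun p : Y × (ℕ → Z) => R (chain Ψ p.1 p.2 k) (p.2 k) :=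
  hR.comp_measurable
    ((measurable_chain hΨ k).prodMk ((measurable_pi_apply k).comp measurable_snd))

include hΨ hw hR hC hRw in
lemma lintegral_tsum_chain_le (y : Y) :
    ∫⁻ ω, ∑' k, ‖R (chain Ψ y ω k) (ω k)‖ₑ ∂(Measure.infinitePi fun _ => μ)
      ≤ 2 * C * w y := by
  have hm : ∀ k, Measurable fun ω : ℕ → Z => ‖R (chain Ψ y ω k) (ω k)‖ₑ := fun k =>
    ((stronglyMeasurable_chain_reward hΨ hR k).comp_measurable measurable_prodMk_left).enorm
  rw [lintegral_tsum fun k => (hm k).aemeasurable]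
  calc ∑' k, ∫⁻ ω, ‖R (chain Ψ y ω k) (ω k)‖ₑ ∂(Measure.infinitePi fun _ => μ)
      ≤ ∑' k : ℕ, C * 2⁻¹ ^ k * w y :=
        ENNReal.tsum_le_tsum fun k => lintegral_chain_le μ hΨ hw hR.enorm hC hRw y k
    _ = 2 * C * w y := by
        rw [ENNReal.tsum_mul_right, ENNReal.tsum_mul_left, ENNReal.tsum_geometric,
          ENNReal.one_sub_inv_two, inv_inv]
        ring

include hΨ hw hR hC hRw in
lemma lintegral_enorm_chainTotal_le (y : Y) :
    ∫⁻ ω, ‖chainTotal Ψ R y ω‖ₑ ∂(Measure.infinitePi fun _ => μ) ≤ 2 * C * w y := by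
  refine le_trans (lintegral_mono_ae ?_) (lintegral_tsum_chain_le μ hΨ hw hR hC hRw y)
  filter_upwards with ω
  exact enorm_tsum_le_tsum_enorm

include hΨ hw hR hC hRw in
lemma enorm_integral_chainTotal_le [NormedSpace ℝ E] (y : Y) :
    ‖∫ ω, chainTotal Ψ R y ω ∂(Measure.infinitePi fun _ => μ)‖ₑ ≤ 2 * C * w y :=
  (enorm_integral_le_lintegral_enorm _).trans
    (lintegral_enorm_chainTotal_le μ hΨ hw hR hC hRw y)

include hΨ hwtop hw hR hC hRw

lemma ae_tsum_chain_ne_top (y : Y) :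
    ∀ᵐ ω ∂(Measure.infinitePi fun _ => μ), ∑' k, ‖R (chain Ψ y ω k) (ω k)‖ₑ ≠ ⊤ := by
  have hm : ∀ k, Measurable fun ω : ℕ → Z => ‖R (chain Ψ y ω k) (ω k)‖ₑ := fun k =>
    ((stronglyMeasurable_chain_reward hΨ hR k).comp_measurable measurable_prodMk_left).enorm
  have h := lintegral_tsum_chain_le μ hΨ hw hR hC hRw y
  have h2 : 2 * C * w y ≠ ⊤ := ENNReal.mul_ne_top (ENNReal.mul_ne_top (by simp) hC) (hwtop y)
  filter_upwards [ae_lt_top (Measurable.tsum hm) (ne_top_of_le_ne_top h2 h)]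
    with ω hω using hω.ne

lemma stronglyMeasurable_integral_chainTotal [NormedSpace ℝ E] :
    StronglyMeasurable fun y => ∫ ω, chainTotal Ψ R y ω ∂(Measure.infinitePi fun _ => μ) := by
  have hm := fun k => stronglyMeasurable_chain_reward hΨ hR k
  refine stronglyMeasurable_of_tendsto (u := Filter.atTop)
    (f := fun (N : ℕ) y => ∑ k ∈ Finset.range N,
      ∫ ω, R (chain Ψ y ω k) (ω k) ∂(Measure.infinitePi fun _ => μ)) (fun N => ?_) ?_
  · exact Finset.stronglyMeasurable_fun_sum _ fun k _ => (hm k).integral_prod_right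
  · rw [tendsto_pi_nhds]
    intro y
    have hle := fun k => lintegral_chain_le μ hΨ hw hR.enorm hC hRw y k
    have hbtop : ∀ k : ℕ, C * 2⁻¹ ^ k * w y ≠ ⊤ := fun k =>
      ENNReal.mul_ne_top (ENNReal.mul_ne_top hC (by simp)) (hwtop y)
    have hint : ∀ k, Integrable (fun ω => R (chain Ψ y ω k) (ω k))
        (Measure.infinitePi fun _ => μ) := fun k =>
      ⟨((hm k).comp_measurable measurable_prodMk_left).aestronglyMeasurable,
        lt_of_le_of_lt (hle k) (hbtop k).lt_top⟩
    refine HasSum.tendsto_sum_nat (hasSum_integral_of_summable_integral_norm hint ?_)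
    have hsum : ∑' k : ℕ, C * 2⁻¹ ^ k * w y ≠ ⊤ := by
      rw [ENNReal.tsum_mul_right, ENNReal.tsum_mul_left, ENNReal.tsum_geometric,
          ENNReal.one_sub_inv_two, inv_inv]
      exact ENNReal.mul_ne_top (ENNReal.mul_ne_top hC (by simp)) (hwtop y)
    refine Summable.of_nonneg_of_le (fun k => integral_nonneg fun _ => norm_nonneg _)
      (fun k => ?_) (ENNReal.summable_toReal hsum)
    rw [integral_norm_eq_lintegral_enorm (hint k).aestronglyMeasurable]
    exact ENNReal.toReal_mono (hbtop k) (hle k)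

variable [CompleteSpace E]

lemma ae_summable_chain (y : Y) :
    ∀ᵐ ω ∂(Measure.infinitePi fun _ => μ), Summable fun k => R (chain Ψ y ω k) (ω k) := by
  filter_upwards [ae_tsum_chain_ne_top μ hΨ hwtop hw hR hC hRw y] with ω hω
  refine Summable.of_norm ?_
  have h := ENNReal.summable_toReal hω
  simpa using h

lemma aestronglyMeasurable_chainTotal (y : Y) :
    AEStronglyMeasurable (chainTotal Ψ R y) (Measure.infinitePi fun _ => μ) := by
  refine aestronglyMeasurable_of_tendsto_ae (u := Filter.atTop)
    (f := fun (N : ℕ) ω => ∑ k ∈ Finset.range N, R (chain Ψ y ω k) (ω k)) (fun N => ?_) ?_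
  · refine Finset.aestronglyMeasurable_fun_sum _ fun k _ => ?_
    exact ((stronglyMeasurable_chain_reward hΨ hR k).comp_measurable
      measurable_prodMk_left).aestronglyMeasurable
  · filter_upwards [ae_summable_chain μ hΨ hwtop hw hR hC hRw y] with ω hω
    exact hω.hasSum.tendsto_sum_nat

lemma integrable_chainTotal (y : Y) :
    Integrable (chainTotal Ψ R y) (Measure.infinitePi fun _ => μ) := by
  refine ⟨aestronglyMeasurable_chainTotal μ hΨ hwtop hw hR hC hRw y, ?_⟩
  refine lt_of_le_of_lt (lintegral_enorm_chainTotal_le μ hΨ hw hR hC hRw y) ?_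
  exact (ENNReal.mul_ne_top (ENNReal.mul_ne_top (by simp) hC) (hwtop y)).lt_top

variable [NormedSpace ℝ E]

/-- Decomposition of the mean total reward at the first step. -/
lemma integral_chainTotal_eq (y : Y) :
    ∫ ω, chainTotal Ψ R y ω ∂(Measure.infinitePi fun _ => μ)
      = ∫ z, (R y z + ∫ ω, chainTotal Ψ R (Ψ y z) ω ∂(Measure.infinitePi fun _ => μ)) ∂μ := by
  have hmp := measurePreserving_seqCons μ
  have hint := integrable_chainTotal μ hΨ hwtop hw hR hC hRw
  have hsplit : ∀ᵐ p ∂(μ.prod (Measure.infinitePi fun _ => μ)),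
      chainTotal Ψ R y (seqCons p.1 p.2) = R y p.1 + chainTotal Ψ R (Ψ y p.1) p.2 := by
    filter_upwards [hmp.quasiMeasurePreserving.ae
      (ae_summable_chain μ hΨ hwtop hw hR hC hRw y)] with p hp
    rw [chainTotal, hp.tsum_eq_zero_add]
    simp only [chain_seqCons_succ]
    rfl
  have hcomp : Integrable (fun p : Z × (ℕ → Z) => chainTotal Ψ R y (seqCons p.1 p.2))
      (μ.prod (Measure.infinitePi fun _ => μ)) := hmp.integrable_comp_of_integrable (hint y)
  have h1 : ∫ ω, chainTotal Ψ R y ω ∂(Measure.infinitePi fun _ => μ)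
      = ∫ p, chainTotal Ψ R y (seqCons p.1 p.2) ∂(μ.prod (Measure.infinitePi fun _ => μ)) := by
    conv_lhs => rw [← hmp.map_eq]
    exact integral_map hmp.measurable.aemeasurable
      (by rw [hmp.map_eq]; exact (hint y).aestronglyMeasurable)
  rw [h1, integral_congr_ae hsplit, integral_prod _ (hcomp.congr hsplit)]
  refine integral_congr_ae (Filter.Eventually.of_forall fun z => ?_)
  dsimp only
  rw [integral_add (integrable_const _) (hint (Ψ y z))]
  simp

end Chain

/-! ### Inverse-transform sampling -/

section Sampling

variable {α : Type*}

lemma sampleList_eq_some_mem {q : α → ℝ} {l : List α} {u : ℝ} {a : α}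
    (h : sampleList q l u = some a) : a ∈ l := by
  induction l generalizing u with
  | nil => simp [sampleList] at h
  | cons b l ih =>
    rw [sampleList] at h
    split_ifs at h with hu
    · simp_all
    · exact List.mem_cons_of_mem _ (ih h)

lemma sampleList_eq_none_iff {q : α → ℝ} (hq : ∀ a, 0 ≤ q a) {l : List α} {u : ℝ}
    (hu : 0 ≤ u) : sampleList q l u = none ↔ (l.map q).sum ≤ u := by
  induction l generalizing u with
  | nil => simpa [sampleList] using hu
  | cons b l ih =>
    rw [sampleList, List.map_cons, List.sum_cons]
    split_ifs with h
    · have : 0 ≤ (l.map q).sum := List.sum_nonneg (by simpa using fun a _ => hq a)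
      simp only [false_iff, not_le]
      linarith
    · rw [ih (by linarith)]
      constructor <;> intro <;> linarith

lemma volume_sampleList_eq_some {q : α → ℝ} (hq : ∀ a, 0 ≤ q a) {l : List α} (hl : l.Nodup)
    {a : α} (ha : a ∈ l) :
    volume {u : ℝ | 0 ≤ u ∧ sampleList q l u = some a} = ENNReal.ofReal (q a) := by
  induction l with
  | nil => simp at ha
  | cons b l ih =>
    rw [List.nodup_cons] at hl
    by_cases hab : a = b
    · subst hab
      have : {u : ℝ | 0 ≤ u ∧ sampleList q (a :: l) u = some a} = Set.Ico 0 (q a) := by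
        ext u
        simp only [Set.mem_ofPred_eq, Set.mem_Ico, sampleList, and_congr_right_iff]
        intro _
        split_ifs with h
        · simpa using h
        · simp only [h, iff_false]
          exact fun h' => hl.1 (sampleList_eq_some_mem h')
      rw [this, Real.volume_Ico, sub_zero]
    · have hal : a ∈ l := by simpa [hab] using ha
      have : {u : ℝ | 0 ≤ u ∧ sampleList q (b :: l) u = some a}
          = (fun u => u - q b) ⁻¹' {u : ℝ | 0 ≤ u ∧ sampleList q l u = some a} := by
        ext u
        simp only [Set.mem_ofPred_eq, Set.mem_preimage, sampleList]
        split_ifs with h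
        · have h1 : b ≠ a := fun h => hab h.symm
          have h2 : ¬ 0 ≤ u - q b := by linarith
          simp [h1, h2]
        · have h1 : 0 ≤ u := (hq b).trans (not_lt.1 h)
          simp [h1, not_lt.1 h]
      simp_rw [sub_eq_add_neg] at this
      rw [this, measure_preimage_add_right, ih hl.2 hal]

variable [Fintype α] [Inhabited α]

lemma sampleList_eq_some_sample {q : α → ℝ} (hq : ∀ a, 0 ≤ q a) (hs : ∑ a, q a = 1) {u : ℝ}
    (hu : u ∈ Set.Ico (0 : ℝ) 1) :
    sampleList q Finset.univ.toList u = some (sample q u) := by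
  have h : sampleList q Finset.univ.toList u ≠ none := by
    rw [Ne, sampleList_eq_none_iff hq hu.1, Finset.sum_map_toList, hs]
    exact not_le.2 hu.2
  obtain ⟨b, hb⟩ := Option.ne_none_iff_exists'.1 h
  simp [sample, hb]

lemma volume_sample_eq {q : α → ℝ} (hq : ∀ a, 0 ≤ q a) (hs : ∑ a, q a = 1) (a : α) :
    volume ({u | sample q u = a} ∩ Set.Ico (0 : ℝ) 1) = ENNReal.ofReal (q a) := by
  rw [← volume_sampleList_eq_some hq (Finset.nodup_toList Finset.univ) (a := a) (by simp)]
  congr 1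
  ext u
  simp only [Set.mem_inter_iff, Set.mem_ofPred_eq]
  constructor
  · rintro ⟨h1, h2⟩
    exact ⟨h2.1, by rw [sampleList_eq_some_sample hq hs h2, h1]⟩
  · rintro ⟨h1, h2⟩
    have h3 : u ∈ Set.Ico (0 : ℝ) 1 := by
      refine ⟨h1, ?_⟩
      have := (sampleList_eq_none_iff hq h1 (l := Finset.univ.toList)).not.1 (by simp [h2])
      rwa [Finset.sum_map_toList, hs, not_le] at this
    rw [sampleList_eq_some_sample hq hs h3] at h2
    exact ⟨by simpa using h2, h3⟩

variable {Ω : Type*} [MeasurableSpace Ω]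

omit [Fintype α] [Inhabited α] in
lemma measurableSet_sampleList_eq {q : Ω → α → ℝ} (hq : ∀ a, Measurable fun ω => q ω a)
    {u : Ω → ℝ} (hu : Measurable u) (l : List α) (o : Option α) :
    MeasurableSet {ω | sampleList (q ω) l (u ω) = o} := by
  induction l generalizing u with
  | nil => exact MeasurableSet.const ((none : Option α) = o)
  | cons b l ih =>
    have : {ω | sampleList (q ω) (b :: l) (u ω) = o}
        = ({ω | u ω < q ω b} ∩ {_ω | some b = o}) ∪
          ({ω | u ω < q ω b}ᶜ ∩ {ω | sampleList (q ω) l (u ω - q ω b) = o}) := by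
      ext ω
      simp only [Set.mem_ofPred_eq, Set.mem_union, Set.mem_inter_iff, Set.mem_compl_iff,
        sampleList]
      split_ifs with h <;> simp [h]
    rw [this]
    have hlt := measurableSet_lt hu (hq b)
    exact (hlt.inter (MeasurableSet.const _)).union (hlt.compl.inter (ih (hu.sub (hq b))))

lemma measurable_sample [MeasurableSpace α] {q : Ω → α → ℝ}
    (hq : ∀ a, Measurable fun ω => q ω a) {u : Ω → ℝ} (hu : Measurable u) :
    Measurable fun ω => sample (q ω) (u ω) := by
  refine measurable_to_countable' fun a => ?_
  have : (fun ω => sample (q ω) (u ω)) ⁻¹' {a}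
      = ⋃ o ∈ {o : Option α | o.getD default = a},
        {ω | sampleList (q ω) Finset.univ.toList (u ω) = o} := by
    ext ω
    simp [sample]
  rw [this]
  exact MeasurableSet.biUnion (Set.to_countable _)
    fun o _ => measurableSet_sampleList_eq hq hu _ o

/-- The uniform distribution on `[0,1]`. -/
abbrev uniform01 : Measure ℝ := volume.restrict (Set.Icc (0 : ℝ) 1)

instance isProbabilityMeasure_uniform01 : IsProbabilityMeasure uniform01 := ⟨by simp⟩

/-- A sample with a uniform variable has the prescribed distribution. -/
lemma lintegral_sample {q : α → ℝ} (hq : ∀ a, 0 ≤ q a) (hs : ∑ a, q a = 1) (f : α → ℝ≥0∞) :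
    ∫⁻ u, f (sample q u) ∂uniform01 = ∑ a, ENNReal.ofReal (q a) * f a := by
  let _ : MeasurableSpace α := ⊤
  have hm : Measurable fun u => sample q u :=
    measurable_sample (q := fun _ : ℝ => q) (fun _ => measurable_const) measurable_id
  have h1 : ∫⁻ u, f (sample q u) ∂uniform01 = ∫⁻ a, f a ∂(uniform01.map (sample q)) :=
    (lintegral_map (measurable_of_countable f) hm).symm
  rw [h1, lintegral_fintype]
  refine Finset.sum_congr rfl fun a _ => ?_
  rw [Measure.map_apply hm (measurableSet_singleton a), uniform01,
    ← restrict_Ico_eq_restrict_Icc, Measure.restrict_apply (hm (measurableSet_singleton a)),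
    mul_comm]
  congr 1
  exact volume_sample_eq hq hs a

end Sampling

/-! ### The exponential distribution -/

open ProbabilityTheory in
lemma lintegral_expMeasure_le {r : ℝ} (hr : 0 < r) {f : ℝ → ℝ≥0∞} (hf : Measurable f) :
    ∫⁻ z, f z ∂(expMeasure r) ≤ ENNReal.ofReal r * ∫⁻ z in Set.Ici 0, f z := by
  have hpdf : Measurable (exponentialPDF r) := (measurable_exponentialPDFReal r).ennreal_ofReal
  have : expMeasure r = volume.withDensity (exponentialPDF r) := rfl
  rw [this, lintegral_withDensity_eq_lintegral_mul _ hpdf hf,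
    ← lintegral_const_mul' _ _ ENNReal.ofReal_ne_top, ← lintegral_indicator measurableSet_Ici]
  refine lintegral_mono fun z => ?_
  rw [Pi.mul_apply]
  by_cases hz : z ∈ Set.Ici (0 : ℝ)
  · rw [Set.indicator_of_mem hz]
    gcongr
    rw [exponentialPDF_of_nonneg hz]
    refine ENNReal.ofReal_le_ofReal ?_
    have : Real.exp (-(r * z)) ≤ 1 := Real.exp_le_one_iff.2 (by
      have := mul_nonneg hr.le (show 0 ≤ z from hz); linarith)
    nlinarith
  · rw [exponentialPDF_of_neg (not_le.1 hz)]
    simp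

open ProbabilityTheory in
lemma ae_pos_expMeasure {r : ℝ} (hr : 0 < r) : ∀ᵐ z ∂(expMeasure r), 0 < z := by
  rw [ae_iff]
  have h := lintegral_expMeasure_le hr
    (f := Set.indicator {z : ℝ | ¬ 0 < z} 1) (measurable_one.indicator (by measurability))
  rw [lintegral_indicator_one (by measurability)] at h
  refine le_antisymm (h.trans ?_) bot_le
  rw [lintegral_indicator_one (by measurability), Measure.restrict_apply (by measurability)]
  have : {z : ℝ | ¬ 0 < z} ∩ Set.Ici 0 = {0} := by
    ext z; simp [le_antisymm_iff]
  rw [this]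
  simp

open ProbabilityTheory in
/-- The Laplace transform of the exponential distribution of rate `r`, at the point `r`. -/
lemma lintegral_exp_neg_expMeasure {r : ℝ} (hr : 0 < r) :
    ∫⁻ z, ENNReal.ofReal (Real.exp (-(r * z))) ∂(expMeasure r) = 2⁻¹ := by
  have hpdf : Measurable (exponentialPDF r) := (measurable_exponentialPDFReal r).ennreal_ofReal
  have : expMeasure r = volume.withDensity (exponentialPDF r) := rfl
  rw [this, lintegral_withDensity_eq_lintegral_mul _ hpdf (by fun_prop)]
  have hr2 : (0 : ℝ) < 2 * r := by linarith
  rw [← mul_one (2⁻¹ : ℝ≥0∞), ← lintegral_exponentialPDF_eq_one hr2,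
    ← lintegral_const_mul' _ _ (by simp)]
  refine lintegral_congr fun z => ?_
  rw [Pi.mul_apply]
  rcases lt_or_ge z 0 with hz | hz
  · simp [exponentialPDF_of_neg hz]
  · rw [exponentialPDF_of_nonneg hz, exponentialPDF_of_nonneg hz,
      ← ENNReal.ofReal_mul (by positivity)]
    have : (2⁻¹ : ℝ≥0∞) = ENNReal.ofReal 2⁻¹ := by
      rw [ENNReal.ofReal_inv_of_pos (by norm_num)]; simp
    rw [this, ← ENNReal.ofReal_mul (by norm_num)]
    congr 1
    rw [mul_assoc, ← Real.exp_add]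
    ring_nf

/-! ### Policies defined for all times and inventories -/

/-- Purchases form a discrete measurable space. -/
instance measurableSpaceOptionFin {n : ℕ} : MeasurableSpace (Option (Fin n)) := ⊤

instance {n : ℕ} : DiscreteMeasurableSpace (Option (Fin n)) := ⟨fun _ => trivial⟩

namespace RevenueNetwork

variable {m n : ℕ} (M : RevenueNetwork m n)

/-- A policy with values in the probability distributions for all times and inventories, which
offers nothing outside of `[0, T] × {x ≤ c}`. -/
structure IsRegular (π : Policy m n) : Prop where
  measurable : ∀ x S, Measurable fun t => π t x S
  nonneg : ∀ t x S, 0 ≤ π t x S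
  sum_eq_one : ∀ t x, ∑ S, π t x S = 1
  idle : ∀ t x, ¬ (t ∈ Set.Icc 0 M.T ∧ x ≤ M.c) → ∀ S, π t x S = if S = ∅ then 1 else 0

lemma P_empty (o : Option (Fin n)) : M.P ∅ o = if o = none then 1 else 0 := by
  cases o with
  | some j => simpa using M.P_eq_zero ∅ j (by simp)
  | none =>
    have h := M.P_sum ∅
    rw [Fintype.sum_option, Finset.sum_eq_zero fun j _ => M.P_eq_zero ∅ j (by simp)] at h
    simpa using h

lemma P_le_one (S : Assortment n) (o : Option (Fin n)) : M.P S o ≤ 1 :=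
  M.P_sum S ▸ Finset.single_le_sum (fun o _ => M.P_nonneg S o) (Finset.mem_univ o)

/-- The inventory after a purchase. -/
def depleteBy (x : Inventory m) : Option (Fin n) → Inventory m
  | none => x
  | some j => M.deplete x j

/-- The transition from (time, inventory) just after a customer to that just after the
next one. -/
def step (π : Policy m n) (y : ℝ × Inventory m) (z : Customer) : ℝ × Inventory m :=
  (y.1 + z.1, M.depleteBy y.2 (M.purchase π (y.1 + z.1) y.2 z))

/-- What is collected between a customer and the next one: the running reward `h`, and the
reward `f` for a sale to the latter. -/
def reward {E : Type*} [NormedAddCommGroup E] [NormedSpace ℝ E] (π : Policy m n)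
    (h : ℝ → Inventory m → E) (f : ℝ → Inventory m → Assortment n → Fin n → E)
    (y : ℝ × Inventory m) (z : Customer) : E :=
  (∫ s in y.1..(y.1 + z.1), h s y.2) +
    (M.purchase π (y.1 + z.1) y.2 z).elim 0
      (f (y.1 + z.1) y.2 (sample (π (y.1 + z.1) y.2) z.2.1))

lemma chain_step (π : Policy m n) (t : ℝ) (x : Inventory m) (ω : ℕ → Customer) (k : ℕ) :
    chain (M.step π) (t, x) ω k
      = (t + ∑ i ∈ Finset.range k, (ω i).1, M.stateAfter π t x ω k) := by
  induction k with
  | zero => simp [chain, stateAfter]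
  | succ k ih =>
    rw [chain, ih, step, stateAfter]
    simp only [arrival, Finset.sum_range_succ, add_assoc]
    congr 1

/-- It suffices to check measurability at each inventory. -/
lemma measurable_of_inventory {F Z : Type*} [MeasurableSpace F] [MeasurableSpace Z]
    {g : (ℝ × Inventory m) × Z → F}
    (hg : ∀ x, Measurable fun p : ℝ × Z => g ((p.1, x), p.2)) : Measurable g := by
  have h : Measurable fun q : (ℝ × Z) × Inventory m => g ((q.1.1, q.2), q.1.2) :=
    measurable_from_prod_countable_left hg
  exact h.comp (by fun_prop : Measurable fun p : (ℝ × Inventory m) × Z => ((p.1.1, p.2), p.1.2))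

section Regular

variable {M} {π : Policy m n} (hπ : M.IsRegular π)

include hπ

lemma IsRegular.measurable_sample {Ω : Type*} [MeasurableSpace Ω] {s u : Ω → ℝ}
    (hs : Measurable s) (hu : Measurable u) (x : Inventory m) :
    Measurable fun ω => sample (π (s ω) x) (u ω) :=
  _root_.measurable_sample (fun S => (hπ.measurable x S).comp hs) hu

lemma IsRegular.measurable_purchase {Ω : Type*} [MeasurableSpace Ω] {s : Ω → ℝ}
    {z : Ω → Customer} (hs : Measurable s) (hz : Measurable z) (x : Inventory m) :
    Measurable fun ω => M.purchase π (s ω) x (z ω) := by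
  unfold purchase
  refine Measurable.ite (measurableSet_le hs measurable_const) ?_ measurable_const
  refine _root_.measurable_sample (fun o => ?_) (by fun_prop)
  exact (measurable_of_countable fun S => M.P S o).comp
    (hπ.measurable_sample hs (by fun_prop) x)

lemma IsRegular.measurable_step :
    Measurable fun p : (ℝ × Inventory m) × Customer => M.step π p.1 p.2 := by
  refine measurable_of_inventory fun x => ?_
  refine Measurable.prodMk (by fun_prop) ?_
  exact (measurable_of_countable (M.depleteBy x)).comp
    (hπ.measurable_purchase (by fun_prop) (by fun_prop) x)

lemma IsRegular.stronglyMeasurable_reward {E : Type*} [NormedAddCommGroup E] [NormedSpace ℝ E]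
    [MeasurableSpace E] [BorelSpace E] [SecondCountableTopology E]
    {h : ℝ → Inventory m → E} (hh : ∀ x, Integrable fun s => h s x)
    {f : ℝ → Inventory m → Assortment n → Fin n → E}
    (hf : ∀ x S j, Measurable fun s => f s x S j) :
    StronglyMeasurable fun p : (ℝ × Inventory m) × Customer => M.reward π h f p.1 p.2 := by
  refine Measurable.stronglyMeasurable (measurable_of_inventory fun x => ?_)
  refine Measurable.add ?_ ?_
  · have h1 : ∀ a b : ℝ, ∫ s in a..b, h s x = (∫ s in (0 : ℝ)..b, h s x)
        - ∫ s in (0 : ℝ)..a, h s x := fun a b =>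
      (intervalIntegral.integral_interval_sub_left (hh x).intervalIntegrable
        (hh x).intervalIntegrable).symm
    have h2 := ((hh x).continuous_primitive 0).measurable
    change Measurable fun p : ℝ × Customer => ∫ s in p.1..(p.1 + p.2.1), h s x
    rw [funext fun p : ℝ × Customer => h1 p.1 (p.1 + p.2.1)]
    exact (h2.comp (by fun_prop)).sub (h2.comp (by fun_prop))
  · have h3 : Measurable fun q : ℝ × (Option (Fin n) × Assortment n) =>
        q.2.1.elim 0 (f q.1 x q.2.2) := by
      refine measurable_from_prod_countable_left fun r => ?_
      obtain ⟨o, S⟩ := r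
      cases o with
      | none => exact measurable_const
      | some j => exact hf x S j
    have h4 : Measurable fun p : ℝ × Customer =>
        (p.1 + p.2.1, (M.purchase π (p.1 + p.2.1) x p.2,
          sample (π (p.1 + p.2.1) x) p.2.2.1)) :=
      Measurable.prodMk (by fun_prop)
        ((hπ.measurable_purchase (by fun_prop) (by fun_prop) x).prodMk
          (hπ.measurable_sample (by fun_prop) (by fun_prop) x))
    exact h3.comp h4

/-- Joint law of the assortment offered and of the purchase, at a fixed time and inventory. -/
lemma IsRegular.lintegral_choice (s : ℝ) (x : Inventory m) (z : ℝ)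
    (g : Assortment n → Option (Fin n) → ℝ≥0∞) :
    ∫⁻ u, g (sample (π s x) u.1) (M.purchase π s x (z, u)) ∂(uniform01.prod uniform01)
      = ∑ S, ∑ o, ENNReal.ofReal (π s x S * M.P S o) * g S o := by
  have hm : Measurable fun u : ℝ × ℝ =>
      g (sample (π s x) u.1) (M.purchase π s x (z, u)) :=
    (measurable_of_countable fun p : Assortment n × Option (Fin n) => g p.1 p.2).comp
      ((hπ.measurable_sample measurable_const measurable_fst x).prodMk
        (hπ.measurable_purchase measurable_const (by fun_prop) x))
  have hmul : ∀ S o, ENNReal.ofReal (π s x S * M.P S o) * g S o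
      = ENNReal.ofReal (π s x S) * (ENNReal.ofReal (M.P S o) * g S o) := fun S o => by
    rw [ENNReal.ofReal_mul (hπ.nonneg s x S), mul_assoc]
  simp only [hmul, ← Finset.mul_sum]
  rw [lintegral_prod _ hm.aemeasurable]
  by_cases hs : s ≤ M.T
  · simp only [purchase, if_pos hs]
    rw [← lintegral_sample (hπ.nonneg s x) (hπ.sum_eq_one s x)]
    refine lintegral_congr fun u => ?_
    exact lintegral_sample (M.P_nonneg _) (M.P_sum _) _
  · -- after the horizon nothing is offered, which agrees with nothing being sold
    simp only [purchase, if_neg hs, lintegral_const, measure_univ, mul_one]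
    rw [lintegral_sample (hπ.nonneg s x) (hπ.sum_eq_one s x) fun S => g S none]
    refine Finset.sum_congr rfl fun S _ => ?_
    rw [hπ.idle s x fun h => hs h.1.2]
    split_ifs with hS
    · subst hS
      simp [M.P_empty, Fintype.sum_option]
    · simp

lemma IsRegular.integral_choice {E : Type*} [NormedAddCommGroup E] [NormedSpace ℝ E]
    [CompleteSpace E]
    (s : ℝ) (x : Inventory m) (z : ℝ) (g : Assortment n → Option (Fin n) → E) :
    ∫ u, g (sample (π s x) u.1) (M.purchase π s x (z, u)) ∂(uniform01.prod uniform01)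
      = ∑ S, ∑ o, (π s x S * M.P S o) • g S o := by
  set φ : ℝ × ℝ → Assortment n × Option (Fin n) := fun u =>
    (sample (π s x) u.1, M.purchase π s x (z, u)) with hφdef
  have hφ : Measurable φ := (hπ.measurable_sample measurable_const measurable_fst x).prodMk
        (hπ.measurable_purchase measurable_const (by fun_prop) x)
  have h1 : ∫ u, g (sample (π s x) u.1) (M.purchase π s x (z, u)) ∂(uniform01.prod uniform01)
      = ∫ p, g p.1 p.2 ∂((uniform01.prod uniform01).map φ) :=
    (integral_map hφ.aemeasurable
      (StronglyMeasurable.of_discrete (f := fun p : Assortment n × Option (Fin n) =>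
        g p.1 p.2)).aestronglyMeasurable).symm
  have : IsProbabilityMeasure ((uniform01.prod uniform01).map φ) :=
    Measure.isProbabilityMeasure_map hφ.aemeasurable
  rw [h1, integral_fintype .of_finite, Fintype.sum_prod_type]
  refine Finset.sum_congr rfl fun S _ => Finset.sum_congr rfl fun o _ => ?_
  congr 1
  rw [Measure.real, Measure.map_apply hφ (measurableSet_singleton _)]
  have h2 := hπ.lintegral_choice s x z (fun S' o' => if S' = S ∧ o' = o then 1 else 0)
  rw [Finset.sum_eq_single S (fun S' _ h => by simp [h]) (by simp),
    Finset.sum_eq_single o (fun o' _ h => by simp [h]) (by simp)] at h2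
  have h3 : (uniform01.prod uniform01) (φ ⁻¹' {(S, o)})
      = ENNReal.ofReal (π s x S * M.P S o) := by
    rw [← lintegral_indicator_one (hφ (measurableSet_singleton _))]
    simp only [and_self, if_true, mul_one] at h2
    rw [← h2]
    refine lintegral_congr fun u => ?_
    by_cases hu : sample (π s x) u.1 = S ∧ M.purchase π s x (z, u) = o
    · rw [if_pos hu, Set.indicator_of_mem (by simp [φ, hu])]
      rfl
    · rw [if_neg hu, Set.indicator_of_notMem (by simpa [φ] using hu)]
  rw [h3, ENNReal.toReal_ofReal (mul_nonneg (hπ.nonneg _ _ _) (M.P_nonneg _ _))]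

/-- Joint law of the arrival time, the assortment offered and the purchase of the next
customer. -/
lemma IsRegular.lintegral_customer (t : ℝ) (x : Inventory m)
    {g : ℝ → Assortment n → Option (Fin n) → ℝ≥0∞} (hg : ∀ S o, Measurable fun z => g z S o) :
    ∫⁻ z, g z.1 (sample (π (t + z.1) x) z.2.1) (M.purchase π (t + z.1) x z) ∂M.customerLaw
      = ∫⁻ z, ∑ S, ∑ o, ENNReal.ofReal (π (t + z) x S * M.P S o) * g z S o
          ∂(ProbabilityTheory.expMeasure M.rate) := by
  have h1 : Measurable fun q : ℝ × (Assortment n × Option (Fin n)) => g q.1 q.2.1 q.2.2 :=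
    measurable_from_prod_countable_left fun r => hg r.1 r.2
  have hm : Measurable fun z : Customer =>
      g z.1 (sample (π (t + z.1) x) z.2.1) (M.purchase π (t + z.1) x z) :=
    h1.comp (Measurable.prodMk measurable_fst
      ((hπ.measurable_sample (by fun_prop) (by fun_prop) x).prodMk
        (hπ.measurable_purchase (by fun_prop) (by fun_prop) x)))
  rw [customerLaw, lintegral_prod _ hm.aemeasurable]
  exact lintegral_congr fun z => hπ.lintegral_choice (t + z) x z (g z)

lemma IsRegular.integral_customer {E : Type*} [NormedAddCommGroup E] [NormedSpace ℝ E]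
    [CompleteSpace E]
    (t : ℝ) (x : Inventory m) {g : ℝ → Assortment n → Option (Fin n) → E}
    (hg : Integrable (fun z : Customer =>
      g z.1 (sample (π (t + z.1) x) z.2.1) (M.purchase π (t + z.1) x z)) M.customerLaw) :
    ∫ z, g z.1 (sample (π (t + z.1) x) z.2.1) (M.purchase π (t + z.1) x z) ∂M.customerLaw
      = ∫ z, ∑ S, ∑ o, (π (t + z) x S * M.P S o) • g z S o
          ∂(ProbabilityTheory.expMeasure M.rate) := by
  have : IsProbabilityMeasure (ProbabilityTheory.expMeasure M.rate) :=
    ProbabilityTheory.isProbabilityMeasure_expMeasure M.rate_pos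
  rw [customerLaw] at hg ⊢
  rw [integral_prod _ hg]
  exact integral_congr_ae (.of_forall fun z => hπ.integral_choice (t + z) x z (g z))

end Regular

/-- An exponential weight, whose mean is halved by each customer. -/
def weight (t : ℝ) : ℝ≥0∞ := ENNReal.ofReal (Real.exp (-(M.rate * t)))

lemma weight_ne_top (t : ℝ) : M.weight t ≠ ⊤ := ENNReal.ofReal_ne_top

lemma weight_add (t z : ℝ) : M.weight (t + z) = M.weight t * M.weight z := by
  rw [weight, weight, weight, ← ENNReal.ofReal_mul (by positivity), ← Real.exp_add]
  ring_nf

lemma measurable_weight : Measurable M.weight := by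
  unfold weight; fun_prop

lemma lintegral_weight_add (t : ℝ) :
    ∫⁻ z, M.weight (t + z) ∂(ProbabilityTheory.expMeasure M.rate) = 2⁻¹ * M.weight t := by
  simp only [weight_add]
  rw [lintegral_const_mul' _ _ (M.weight_ne_top t), mul_comm]
  congr 1
  exact lintegral_exp_neg_expMeasure M.rate_pos

lemma map_fst_customerLaw :
    M.customerLaw.map Prod.fst = ProbabilityTheory.expMeasure M.rate := by
  have : IsProbabilityMeasure (volume.restrict (Set.Icc (0 : ℝ) 1)) := ⟨by simp⟩
  have : IsProbabilityMeasure (ProbabilityTheory.expMeasure M.rate) :=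
    ProbabilityTheory.isProbabilityMeasure_expMeasure M.rate_pos
  rw [customerLaw]
  exact Measure.fst_prod

lemma lintegral_weight_step (π : Policy m n) (y : ℝ × Inventory m) :
    ∫⁻ z, M.weight (M.step π y z).1 ∂M.customerLaw ≤ 2⁻¹ * M.weight y.1 := by
  rw [← M.lintegral_weight_add y.1, ← M.map_fst_customerLaw,
    lintegral_map (f := fun z => M.weight (y.1 + z))
      (M.measurable_weight.comp (by fun_prop)) measurable_fst]
  rfl

lemma ae_customer_pos : ∀ᵐ z ∂M.customerLaw, 0 < z.1 := by
  have h := ae_pos_expMeasure M.rate_pos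
  rw [← M.map_fst_customerLaw] at h
  exact ae_of_ae_map measurable_fst.aemeasurable h

end RevenueNetwork

namespace RevenueNetwork

variable {m n : ℕ} (M : RevenueNetwork m n)

/-! ### Trajectories -/

/-- The waiting times are positive and the arrival times tend to infinity. -/
def IsGood (ω : ℕ → Customer) : Prop :=
  (∀ k, 0 < (ω k).1) ∧
    Filter.Tendsto (fun k => ∑ i ∈ Finset.range k, (ω i).1) Filter.atTop Filter.atTop

/-- The sum of the weights at the arrival times has finite mean, which prevents the arrival times
from accumulating. -/
lemma ae_isGood : ∀ᵐ ω ∂M.prob, IsGood ω := by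
  have h1 : ∀ᵐ ω ∂M.prob, ∀ k, 0 < (ω k).1 := by
    rw [ae_all_iff]
    intro k
    exact (measurePreserving_eval_infinitePi (fun _ : ℕ => M.customerLaw)
      k).quasiMeasurePreserving.ae M.ae_customer_pos
  have h2 := ae_tsum_chain_ne_top M.customerLaw
    (Ψ := fun (t : ℝ) (z : Customer) => t + z.1) (by fun_prop) (w := M.weight) M.weight_ne_top
    (fun t => M.lintegral_weight_step (fun _ _ _ => 0) (t, 0))
    (R := fun t _ => Real.exp (-(M.rate * t)))
    (Measurable.stronglyMeasurable (by fun_prop)) (C := 1) (by simp)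
    (fun t => by simp [weight, Real.enorm_eq_ofReal (Real.exp_pos _).le]) 0
  filter_upwards [h1, h2] with ω hω hsum
  refine ⟨hω, ?_⟩
  have h3 : ∀ k, chain (fun (t : ℝ) (z : Customer) => t + z.1) 0 ω k
      = ∑ i ∈ Finset.range k, (ω i).1 := fun k => by
    induction k with
    | zero => rfl
    | succ k ih => rw [chain, ih, Finset.sum_range_succ]
  have h4 := ENNReal.tendsto_atTop_zero_of_tsum_ne_top hsum
  simp only [h3, Real.enorm_eq_ofReal (Real.exp_pos _).le] at h4
  have h5 : Filter.Tendsto (fun k => Real.exp (-(M.rate * ∑ i ∈ Finset.range k, (ω i).1)))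
      Filter.atTop (nhds 0) := by
    have := (ENNReal.tendsto_toReal ENNReal.zero_ne_top).comp h4
    simpa [Function.comp_def, ENNReal.toReal_ofReal (Real.exp_pos _).le] using this
  have h6 := Real.tendsto_exp_comp_nhds_zero.1 h5
  have h7 := Filter.tendsto_neg_atBot_atTop.comp h6
  simp only [Function.comp_def, neg_neg] at h7
  exact (Filter.tendsto_const_mul_atTop_of_pos M.rate_pos).1 h7

variable {M}

lemma IsGood.strictMono {ω : ℕ → Customer} (hω : IsGood ω) (t : ℝ) :
    StrictMono (arrival t ω) := by
  refine strictMono_nat_of_lt_succ fun k => ?_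
  rw [arrival, arrival, Finset.sum_range_succ _ (k + 1)]
  linarith [hω.1 (k + 1)]

lemma IsGood.lt_arrival {ω : ℕ → Customer} (hω : IsGood ω) (t : ℝ) (k : ℕ) :
    t < arrival t ω k := by
  have h : 0 < ∑ i ∈ Finset.range (k + 1), (ω i).1 :=
    Finset.sum_pos (fun i _ => hω.1 i) (by simp)
  rw [arrival]; linarith

lemma IsGood.exists_lt_arrival {ω : ℕ → Customer} (hω : IsGood ω) (t T : ℝ) :
    ∃ N, ∀ k ≥ N, T < arrival t ω k := by
  obtain ⟨N, hN⟩ := Filter.eventually_atTop.1 (hω.2.eventually_gt_atTop (T - t))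
  refine ⟨N, fun k hk => ?_⟩
  have := hN (k + 1) (by omega)
  rw [arrival]; linarith

lemma IsGood.countBefore_eq {ω : ℕ → Customer} (hω : IsGood ω) {t s : ℝ} {k : ℕ}
    (h1 : t + ∑ i ∈ Finset.range k, (ω i).1 < s) (h2 : s ≤ arrival t ω k) :
    countBefore t ω s = k := by
  have : {i : ℕ | arrival t ω i < s} = (Finset.range k : Set ℕ) := by
    ext i
    simp only [Set.mem_ofPred_eq, Finset.coe_range, Set.mem_Iio]
    constructor
    · intro hi
      exact (hω.strictMono t).lt_iff_lt.1 (hi.trans_le h2)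
    · intro hi
      cases k with
      | zero => omega
      | succ k => exact ((hω.strictMono t).monotone (Nat.lt_succ_iff.1 hi)).trans_lt h1
  rw [countBefore, this, Set.ncard_coe_finset, Finset.card_range]

lemma IsGood.stateLeft_eq {π : Policy m n} {x : Inventory m} {ω : ℕ → Customer}
    (hω : IsGood ω) {t s : ℝ} {k : ℕ}
    (h1 : t + ∑ i ∈ Finset.range k, (ω i).1 < s) (h2 : s ≤ arrival t ω k) :
    M.stateLeft π t x ω s = M.stateAfter π t x ω k := by
  rw [stateLeft, hω.countBefore_eq h1 h2]

lemma IsGood.lt_arrival_self {ω : ℕ → Customer} (hω : IsGood ω) (t : ℝ) (k : ℕ) :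
    t + ∑ i ∈ Finset.range k, (ω i).1 < arrival t ω k := by
  rw [arrival, Finset.sum_range_succ]
  linarith [hω.1 k]

lemma sale_eq_none {π : Policy m n} {t : ℝ} {x : Inventory m} {ω : ℕ → Customer} {k : ℕ}
    (h : M.T < arrival t ω k) : M.sale π t x ω k = none := by
  rw [sale, purchase, if_neg (not_le.2 h)]

/-- The integral against `dN_j` of each product is a finite sum over the sales. -/
lemma IsGood.sum_integral_saleMeasure {E : Type*} [NormedAddCommGroup E] [NormedSpace ℝ E]
    [CompleteSpace E]
    {π : Policy m n} {t : ℝ} {x : Inventory m} {ω : ℕ → Customer} (hω : IsGood ω) {N : ℕ}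
    (hN : ∀ k ≥ N, M.T < arrival t ω k) (F : Fin n → ℝ → E) :
    ∑ j, ∫ s in Set.Ioc t M.T, F j s ∂(M.saleMeasure π t x ω j)
      = ∑ k ∈ Finset.range N,
          (M.sale π t x ω k).elim 0 fun j => F j (arrival t ω k) := by
  have h1 : ∀ j, (M.saleMeasure π t x ω j).restrict (Set.Ioc t M.T)
      = ∑ k ∈ Finset.range N,
        if M.sale π t x ω k = some j then Measure.dirac (arrival t ω k) else 0 := by
    intro j
    ext A hA
    rw [Measure.restrict_apply hA, saleMeasure,
      Measure.sum_apply _ (hA.inter measurableSet_Ioc), Measure.finsetSum_apply,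
      tsum_eq_sum (s := Finset.range N)]
    · refine Finset.sum_congr rfl fun k _ => ?_
      split_ifs with hk
      · rw [Measure.dirac_apply' _ (hA.inter measurableSet_Ioc), Measure.dirac_apply' _ hA]
        have hmem : arrival t ω k ∈ Set.Ioc t M.T := by
          refine ⟨hω.lt_arrival t k, ?_⟩
          by_contra hcon
          simp [sale_eq_none (not_le.1 hcon)] at hk
        by_cases hAm : arrival t ω k ∈ A
        · rw [Set.indicator_of_mem hAm, Set.indicator_of_mem (Set.mem_inter hAm hmem)]
        · rw [Set.indicator_of_notMem hAm, Set.indicator_of_notMem fun h => hAm h.1]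
      · rfl
    · intro k hk
      rw [Finset.mem_range, not_lt] at hk
      simp [sale_eq_none (hN k hk)]
  have h2 : ∀ j, ∫ s in Set.Ioc t M.T, F j s ∂(M.saleMeasure π t x ω j)
      = ∑ k ∈ Finset.range N, if M.sale π t x ω k = some j then F j (arrival t ω k) else 0 := by
    intro j
    rw [h1, integral_finsetSum_measure]
    · refine Finset.sum_congr rfl fun k _ => ?_
      split_ifs <;> simp
    · intro k _
      split_ifs
      · exact integrable_dirac (by simp)
      · exact integrable_zero_measure
  simp only [h2]
  rw [Finset.sum_comm]
  refine Finset.sum_congr rfl fun k _ => ?_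
  cases hk : M.sale π t x ω k with
  | none => simp
  | some j => simp

/-- Rewards for the sales together with a running reward are the total of `reward` along the
chain. -/
lemma IsGood.rewards_eq_chainTotal {E : Type*} [NormedAddCommGroup E] [NormedSpace ℝ E]
    [CompleteSpace E]
    {π : Policy m n} {t : ℝ} {x : Inventory m} {ω : ℕ → Customer} (hω : IsGood ω)
    {h : ℝ → Inventory m → E} (hh : ∀ x, Integrable fun s => h s x)
    (hT : ∀ s x, M.T < s → h s x = 0)
    (f : ℝ → Inventory m → Assortment n → Fin n → E) :
    (∑ j, ∫ s in Set.Ioc t M.T, f s (M.stateLeft π t x ω s) (M.offered π t x ω s) j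
        ∂(M.saleMeasure π t x ω j)) + ∫ s in t..M.T, h s (M.stateLeft π t x ω s)
      = chainTotal (M.step π) (M.reward π h f) (t, x) ω := by
  obtain ⟨N, hN⟩ := hω.exists_lt_arrival t M.T
  set τ : ℕ → ℝ := fun k => t + ∑ i ∈ Finset.range k, (ω i).1 with hτ
  have hlt : ∀ k, τ k < τ (k + 1) := fun k => hω.lt_arrival_self t k
  have hNT : M.T ≤ τ (N + 1) := (hN N le_rfl).le
  have hzero : ∀ a b, M.T ≤ a → a ≤ b → ∀ g : ℝ → Inventory m,
      ∫ s in a..b, h s (g s) = 0 := by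
    intro a b ha hab g
    rw [intervalIntegral.integral_congr_ae (g := fun _ => 0), intervalIntegral.integral_zero]
    refine .of_forall fun s hs => hT _ _ ?_
    rw [Set.uIoc_of_le hab] at hs
    exact ha.trans_lt hs.1
  have hpiece : ∀ k, Set.EqOn (fun s => h s (M.stateAfter π t x ω k))
      (fun s => h s (M.stateLeft π t x ω s)) (Set.uIoc (τ k) (τ (k + 1))) := by
    intro k s hs
    rw [Set.uIoc_of_le (hlt k).le] at hs
    simp only [hω.stateLeft_eq hs.1 hs.2]
  have hint : ∀ k, IntervalIntegrable (fun s => h s (M.stateLeft π t x ω s)) volume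
      (τ k) (τ (k + 1)) := fun k => (hh _).intervalIntegrable.congr (hpiece k)
  have hrun : ∫ s in t..M.T, h s (M.stateLeft π t x ω s)
      = ∑ k ∈ Finset.range (N + 1),
        ∫ s in (τ k)..(τ (k + 1)), h s (M.stateAfter π t x ω k) := by
    have h1 : ∑ k ∈ Finset.range (N + 1),
        ∫ s in (τ k)..(τ (k + 1)), h s (M.stateAfter π t x ω k)
        = ∫ s in t..τ (N + 1), h s (M.stateLeft π t x ω s) := by
      have h0 : τ 0 = t := by simp [hτ]
      have h0' := intervalIntegral.sum_integral_adjacent_intervals (n := N + 1)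
        fun k _ => hint k
      rw [h0] at h0'
      rw [← h0']
      exact Finset.sum_congr rfl fun k _ =>
        intervalIntegral.integral_congr_ae (.of_forall fun s hs => hpiece k hs)
    have h2 : IntervalIntegrable (fun s => h s (M.stateLeft π t x ω s)) volume M.T
        (τ (N + 1)) := by
      refine (intervalIntegrable_const (c := (0 : E))).congr fun s hs => ?_
      rw [Set.uIoc_of_le hNT] at hs
      exact (hT _ _ hs.1).symm
    have h3 : IntervalIntegrable (fun s => h s (M.stateLeft π t x ω s)) volume t
        (τ (N + 1)) := by
      have := IntervalIntegrable.trans_iterate (n := N + 1) fun k _ => hint k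
      simpa [hτ] using this
    rw [h1, ← intervalIntegral.integral_add_adjacent_intervals (h3.trans h2.symm) h2,
      hzero _ _ le_rfl hNT, add_zero]
  rw [hω.sum_integral_saleMeasure (fun k hk => hN k ((Nat.le_succ N).trans hk))
    (fun j s => f s (M.stateLeft π t x ω s) (M.offered π t x ω s) j), hrun,
    ← Finset.sum_add_distrib, chainTotal]
  simp only [chain_step, reward]
  rw [tsum_eq_sum (s := Finset.range (N + 1))]
  · refine Finset.sum_congr rfl fun k _ => ?_
    have ha : t + ∑ i ∈ Finset.range k, (ω i).1 + (ω k).1 = arrival t ω k := by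
      rw [arrival, Finset.sum_range_succ, add_assoc]
    have hs := hω.stateLeft_eq (M := M) (π := π) (x := x) (hω.lt_arrival_self t k) le_rfl
    have hc := hω.countBefore_eq (hω.lt_arrival_self t k) le_rfl
    rw [ha, add_comm, offered, hs, hc]
    rfl
  · intro k hk
    rw [Finset.mem_range, not_lt] at hk
    have ha : t + ∑ i ∈ Finset.range k, (ω i).1 + (ω k).1 = arrival t ω k := by
      rw [arrival, Finset.sum_range_succ, add_assoc]
    have hgt := hN k (by omega)
    have hτk : M.T ≤ τ k := by
      obtain ⟨i, rfl⟩ : ∃ i, k = i + 1 := ⟨k - 1, by omega⟩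
      exact (hN i (by omega)).le
    rw [ha, purchase, if_neg (not_le.2 hgt)]
    simp only [Option.elim_none, add_zero]
    exact hzero _ _ hτk (hlt k).le fun _ => M.stateAfter π t x ω k

/-! ### Confinement of a policy to the relevant times and inventories -/

variable (M)

open Classical in
/-- The policy which follows `π` at the times in `[0, T]` and inventories `≤ c`, and offers
nothing elsewhere. -/
def confine (π : Policy m n) : Policy m n := fun t x S =>
  if t ∈ Set.Icc 0 M.T ∧ x ≤ M.c then π t x S else if S = ∅ then 1 else 0

variable {M}

lemma confine_of_mem (π : Policy m n) {t : ℝ} (ht : t ∈ Set.Icc 0 M.T) {x : Inventory m}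
    (hx : x ≤ M.c) : M.confine π t x = π t x := by
  ext S; rw [confine, if_pos ⟨ht, hx⟩]

lemma confine_of_not (π : Policy m n) {t : ℝ} {x : Inventory m}
    (h : ¬ (t ∈ Set.Icc 0 M.T ∧ x ≤ M.c)) (S : Assortment n) :
    M.confine π t x S = if S = ∅ then 1 else 0 := by
  rw [confine, if_neg h]

lemma confine_induction {p : (Assortment n → ℝ) → Prop} {π : Policy m n} {t : ℝ}
    {x : Inventory m} (h1 : t ∈ Set.Icc 0 M.T → x ≤ M.c → p (π t x))
    (h2 : p fun S => if S = ∅ then 1 else 0) : p (M.confine π t x) := by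
  by_cases h : t ∈ Set.Icc 0 M.T ∧ x ≤ M.c
  · rw [confine_of_mem π h.1 h.2]; exact h1 h.1 h.2
  · rw [funext (confine_of_not π h)]; exact h2

lemma IsAdmissible.isRegular_confine {π : Policy m n} (hπ : M.IsAdmissible π) :
    M.IsRegular (M.confine π) where
  measurable x S := by
    by_cases hx : x ≤ M.c
    · refine measurable_of_restrict_of_restrict_compl (s := Set.Icc 0 M.T) measurableSet_Icc ?_ ?_
      · convert hπ.measurable x hx S using 2 with t
        exact congr_fun (confine_of_mem π t.2 hx) S
      · have : (Set.Icc 0 M.T)ᶜ.domRestrict (fun t => M.confine π t x S)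
            = fun _ => if S = ∅ then 1 else 0 := by
          ext t
          exact confine_of_not π (fun h => t.2 h.1) S
        rw [this]
        exact measurable_const
    · simp only [confine_of_not π fun h => hx h.2]
      exact measurable_const
  nonneg t x := confine_induction (p := fun q => ∀ S, 0 ≤ q S)
    (fun ht hx => hπ.nonneg t ht x hx) fun S => by positivity
  sum_eq_one t x := confine_induction (p := fun q => ∑ S, q S = 1)
    (fun ht hx => hπ.sum_eq_one t ht x hx) (by simp)
  idle t x h := confine_of_not π h

lemma deplete_le (x : Inventory m) (j : Fin n) : M.deplete x j ≤ x := fun _ => Nat.sub_le _ _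

lemma purchase_confine (π : Policy m n) {s : ℝ} (hs : 0 ≤ s) {x : Inventory m} (hx : x ≤ M.c)
    (z : Customer) : M.purchase (M.confine π) s x z = M.purchase π s x z := by
  unfold purchase
  split_ifs with h
  · rw [confine_of_mem π ⟨hs, h⟩ hx]
  · rfl

section

variable (π : Policy m n) {t : ℝ} (ht : 0 ≤ t) {x : Inventory m} (hx : x ≤ M.c)
  {ω : ℕ → Customer} (hω : IsGood ω)

include hx in
lemma stateAfter_le (k : ℕ) : M.stateAfter π t x ω k ≤ M.c := by
  induction k with
  | zero => exact hx
  | succ k ih =>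
    rw [stateAfter]
    cases M.purchase π (arrival t ω k) (M.stateAfter π t x ω k) (ω k) with
    | none => exact ih
    | some j => exact (deplete_le _ j).trans ih

include ht hx hω

lemma stateAfter_confine (k : ℕ) :
    M.stateAfter (M.confine π) t x ω k = M.stateAfter π t x ω k := by
  induction k with
  | zero => rfl
  | succ k ih =>
    rw [stateAfter, stateAfter, ih, purchase_confine π (ht.trans (hω.lt_arrival t k).le)
      (stateAfter_le π hx k)]

lemma stateLeft_confine : M.stateLeft (M.confine π) t x ω = M.stateLeft π t x ω := by
  ext1 s
  rw [stateLeft, stateLeft, stateAfter_confine π ht hx hω]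

lemma offered_confine {s : ℝ} (hs : s ∈ Set.Ioc t M.T) :
    M.offered (M.confine π) t x ω s = M.offered π t x ω s := by
  rw [offered, offered, stateLeft_confine π ht hx hω, stateLeft,
    confine_of_mem π ⟨ht.trans hs.1.le, hs.2⟩ (stateAfter_le π hx _)]

lemma saleMeasure_confine (j : Fin n) :
    M.saleMeasure (M.confine π) t x ω j = M.saleMeasure π t x ω j := by
  unfold saleMeasure sale
  simp only [stateAfter_confine π ht hx hω,
    purchase_confine π (ht.trans (hω.lt_arrival t _).le) (stateAfter_le π hx _)]

lemma payoff_confine (htT : t ≤ M.T) :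
    M.payoff (M.confine π) t x ω = M.payoff π t x ω := by
  unfold payoff
  simp only [saleMeasure_confine π ht hx hω, stateLeft_confine π ht hx hω]
  congr 2
  refine intervalIntegral.integral_congr_ae (.of_forall fun s hs => ?_)
  rw [Set.uIoc_of_le htT] at hs
  simp only [entropy, confine_of_mem π ⟨ht.trans hs.1.le, hs.2⟩ (stateAfter_le π hx _),
    stateLeft]

end

lemma J_confine (π : Policy m n) {t : ℝ} (ht : t ∈ Set.Icc 0 M.T) {x : Inventory m}
    (hx : x ≤ M.c) : M.J (M.confine π) t x = M.J π t x := by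
  refine integral_congr_ae ?_
  filter_upwards [M.ae_isGood] with ω hω using payoff_confine π ht.1 hx hω ht.2

lemma gradientSample_confine {d : ℕ} (π : EuclideanSpace ℝ (Fin d) → Policy m n)
    (φ : EuclideanSpace ℝ (Fin d)) {ω : ℕ → Customer} (hω : IsGood ω) :
    M.gradientSample (fun ψ => M.confine (π ψ)) φ ω = M.gradientSample π φ ω := by
  have hx : M.c ≤ M.c := le_rfl
  unfold gradientSample
  simp only [saleMeasure_confine (π φ) le_rfl hx hω, stateLeft_confine (π φ) le_rfl hx hω]
  congr 1
  · refine Finset.sum_congr rfl fun j _ =>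
      setIntegral_congr_fun measurableSet_Ioc fun s (hs : s ∈ Set.Ioc 0 M.T) => ?_
    have hs' : s ∈ Set.Icc 0 M.T := ⟨hs.1.le, hs.2⟩
    have hle : M.stateLeft (π φ) 0 M.c ω s ≤ M.c := stateAfter_le _ hx _
    simp only [offered_confine (π φ) le_rfl hx hω hs, confine_of_mem _ hs' hle,
      J_confine (π φ) hs' hle, J_confine (π φ) hs' ((deplete_le _ j).trans hle)]
  · congr 1
    refine intervalIntegral.integral_congr_ae (.of_forall fun s hs => ?_)
    rw [Set.uIoc_of_le M.T_pos.le] at hs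
    have hs' : s ∈ Set.Icc 0 M.T := ⟨hs.1.le, hs.2⟩
    have hle : M.stateLeft (π φ) 0 M.c ω s ≤ M.c := stateAfter_le _ hx _
    simp only [entropy, confine_of_mem _ hs' hle]

end RevenueNetwork

/-! ### Nonnegative functions with bounded second derivative -/

section Glaeser

open Metric

variable {V : Type*} [NormedAddCommGroup V] [NormedSpace ℝ V] {f : V → ℝ} {φ : V} {r C : ℝ}
  (hf : ContDiffOn ℝ 2 f (ball φ (2 * r)))
  (hC : ∀ ψ ∈ ball φ (2 * r), ‖iteratedFDeriv ℝ 2 f ψ‖ ≤ C)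

include hf hC

/-- First order Taylor estimate. -/
lemma abs_sub_sub_fderiv_le {ψ ψ' : V} (hψ : ψ ∈ ball φ (2 * r)) (hψ' : ψ' ∈ ball φ (2 * r)) :
    |f ψ' - f ψ - fderiv ℝ f ψ (ψ' - ψ)| ≤ C * ‖ψ' - ψ‖ ^ 2 := by
  have hat : ∀ y ∈ ball φ (2 * r), ContDiffAt ℝ 2 f y := fun y hy =>
    hf.contDiffAt (isOpen_ball.mem_nhds hy)
  have hC0 : 0 ≤ C := (norm_nonneg _).trans (hC ψ hψ)
  have hlip : ∀ y ∈ ball φ (2 * r), ‖fderiv ℝ f y - fderiv ℝ f ψ‖ ≤ C * ‖y - ψ‖ := by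
    intro y hy
    refine (convex_ball φ (2 * r)).norm_image_sub_le_of_norm_fderiv_le (𝕜 := ℝ)
      (fun z hz => ?_) (fun z hz => ?_) hψ hy
    · exact ((hat z hz).fderiv_right (m := 1) (by norm_num)).differentiableAt (by simp)
    · rw [← norm_iteratedFDeriv_one, norm_iteratedFDeriv_fderiv]
      exact hC z hz
  have h := ((convex_ball φ (2 * r)).inter
      (convex_closedBall ψ ‖ψ' - ψ‖)).norm_image_sub_le_of_norm_fderiv_le' (𝕜 := ℝ)
      (f := f) (C := C * ‖ψ' - ψ‖) (φ := fderiv ℝ f ψ) (x := ψ) (y := ψ')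
      (fun z hz => (hat z hz.1).differentiableAt (by simp)) (fun z hz => ?_)
      ⟨hψ, by simp⟩ ⟨hψ', by simp [dist_eq_norm]⟩
  · rw [Real.norm_eq_abs] at h
    calc _ ≤ _ := h
      _ = _ := by ring
  · refine (hlip z hz.1).trans (mul_le_mul_of_nonneg_left ?_ hC0)
    simpa [dist_eq_norm] using hz.2

variable (hr : 0 < r) (h0 : ∀ ψ ∈ ball φ (2 * r), 0 ≤ f ψ)

include hr h0

/-- Glaeser's inequality: the derivative of a nonnegative function with bounded second derivative
is controlled by the square root of the function. -/
lemma norm_fderiv_le_sqrt (h1 : ∀ ψ ∈ ball φ (2 * r), f ψ ≤ 1) {ψ : V} (hψ : ψ ∈ ball φ r) :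
    ‖fderiv ℝ f ψ‖ ≤ (2 / r + C * r / 2) * √(f ψ) := by
  have hsub : ball ψ r ⊆ ball φ (2 * r) := by
    refine ball_subset_ball' ?_
    have := mem_ball.1 hψ
    linarith
  have hψ2 : ψ ∈ ball φ (2 * r) := hsub (mem_ball_self hr)
  have hC0 : 0 ≤ C := (norm_nonneg _).trans (hC ψ hψ2)
  rcases (h0 ψ hψ2).eq_or_lt with hz | hpos
  · have hmin : IsLocalMin f ψ := by
      filter_upwards [isOpen_ball.mem_nhds hψ2] with y hy
      rw [← hz]
      exact h0 y hy
    rw [hmin.fderiv_eq_zero, norm_zero]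
    positivity
  have key : ∀ v, fderiv ℝ f ψ v ≤ (2 / r + C * r / 2) * √(f ψ) * ‖v‖ := by
    intro v
    rcases eq_or_ne v 0 with rfl | hv
    · simp
    have hvpos : 0 < ‖v‖ := norm_pos_iff.2 hv
    set a := √(f ψ) with ha
    have hapos : 0 < a := Real.sqrt_pos.2 hpos
    have ha1 : a ≤ 1 := Real.sqrt_le_one.2 (h1 ψ hψ2)
    have hsq : f ψ = a * a := (Real.mul_self_sqrt (h0 ψ hψ2)).symm
    -- a step against the direction `v`, short enough to stay in the ball
    set s := a * r / 2 with hs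
    have hspos : 0 < s := by positivity
    have hsr : s < r := by rw [hs]; nlinarith
    set u : V := -((s / ‖v‖) • v) with hu
    have hun : ‖u‖ = s := by
      rw [hu, norm_neg, norm_smul, Real.norm_of_nonneg (by positivity)]
      field_simp
    have hmem : ψ + u ∈ ball φ (2 * r) := hsub (by simpa [mem_ball, dist_eq_norm, hun] using hsr)
    have ht := (abs_le.1 (abs_sub_sub_fderiv_le hf hC hψ2 hmem)).2
    rw [add_sub_cancel_left, hun] at ht
    have hfu : fderiv ℝ f ψ u = -(s / ‖v‖ * fderiv ℝ f ψ v) := by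
      rw [hu, map_neg, map_smul, smul_eq_mul]
    rw [hfu, hsq] at ht
    have hnn := h0 _ hmem
    have h3 : s / ‖v‖ * fderiv ℝ f ψ v ≤ a * a + C * s ^ 2 := by linarith
    have h4 : s * fderiv ℝ f ψ v ≤ (a * a + C * s ^ 2) * ‖v‖ := by
      rw [div_mul_eq_mul_div, div_le_iff₀ hvpos] at h3
      exact h3
    have h5 : s * ((2 / r + C * r / 2) * a * ‖v‖) = (a * a + C * s ^ 2) * ‖v‖ := by
      rw [hs]; field_simp
    exact le_of_mul_le_mul_left (h5 ▸ h4) hspos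
  refine ContinuousLinearMap.opNorm_le_bound _ (by positivity) fun v => ?_
  rw [Real.norm_eq_abs, abs_le]
  have h6 := key (-v)
  rw [map_neg, norm_neg] at h6
  exact ⟨by linarith, key v⟩

omit hr in
/-- The function `-f log f` is differentiable also where `f` vanishes; there its derivative
is zero, in agreement with the formula since `fderiv ℝ f ψ = 0`. -/
lemma hasFDerivAt_negMulLog_comp {ψ : V} (hψ : ψ ∈ ball φ (2 * r)) :
    HasFDerivAt (fun y => Real.negMulLog (f y)) (-(1 + Real.log (f ψ)) • fderiv ℝ f ψ) ψ := by
  have hat : ContDiffAt ℝ 2 f ψ := hf.contDiffAt (isOpen_ball.mem_nhds hψ)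
  have hd : HasFDerivAt f (fderiv ℝ f ψ) ψ := (hat.differentiableAt (by simp)).hasFDerivAt
  rcases (h0 ψ hψ).eq_or_lt with hz | hpos
  · have hmin : IsLocalMin f ψ := by
      filter_upwards [isOpen_ball.mem_nhds hψ] with y hy
      rw [← hz]
      exact h0 y hy
    rw [hmin.fderiv_eq_zero, smul_zero, hasFDerivAt_iff_isLittleO]
    simp only [← hz, Real.negMulLog_zero, sub_zero, zero_apply]
    -- `-f log f = 2 √f (-√f log √f)`, with `√f` of first order and the other factor vanishing
    have hev : (fun y => Real.negMulLog (f y))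
        =ᶠ[nhds ψ] fun y => 2 * √(f y) * Real.negMulLog √(f y) := by
      filter_upwards [isOpen_ball.mem_nhds hψ] with y hy
      rw [Real.negMulLog, Real.negMulLog, Real.log_sqrt (h0 y hy)]
      nth_rw 1 [← Real.mul_self_sqrt (h0 y hy)]
      ring
    have hO : (fun y => 2 * √(f y)) =O[nhds ψ] fun y => y - ψ := by
      refine Asymptotics.IsBigO.of_bound (2 * √C) ?_
      filter_upwards [isOpen_ball.mem_nhds hψ] with y hy
      have h := (abs_le.1 (abs_sub_sub_fderiv_le hf hC hψ hy)).2
      rw [hmin.fderiv_eq_zero, ← hz] at h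
      simp only [zero_apply, sub_zero] at h
      have h2 := Real.sqrt_le_sqrt h
      rw [Real.sqrt_mul' _ (by positivity), Real.sqrt_sq (norm_nonneg _)] at h2
      rw [Real.norm_of_nonneg (by positivity)]
      linarith
    have ho : (fun y => Real.negMulLog √(f y)) =o[nhds ψ] fun _ => (1 : ℝ) := by
      rw [Asymptotics.isLittleO_one_iff]
      have hc : ContinuousAt (fun y => Real.negMulLog √(f y)) ψ :=
        Real.continuous_negMulLog.continuousAt.comp
          (Real.continuous_sqrt.continuousAt.comp hd.continuousAt)
      have := hc.tendsto
      simpa [← hz] using this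
    refine hev.trans_isLittleO ?_
    have := (hO.norm_right.mul_isLittleO ho)
    simp only [mul_one] at this
    exact this.of_norm_right
  · have h := (Real.hasDerivAt_negMulLog hpos.ne').comp_hasFDerivAt ψ hd
    rw [show -(1 + Real.log (f ψ)) = -Real.log (f ψ) - 1 by ring]
    exact h

lemma norm_fderiv_negMulLog_comp_le (h1 : ∀ ψ ∈ ball φ (2 * r), f ψ ≤ 1) {ψ : V}
    (hψ : ψ ∈ ball φ r) :
    ‖fderiv ℝ (fun y => Real.negMulLog (f y)) ψ‖ ≤ 3 * (2 / r + C * r / 2) := by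
  have hψ2 : ψ ∈ ball φ (2 * r) := ball_subset_ball (by linarith) hψ
  have hC0 : 0 ≤ C := (norm_nonneg _).trans (hC ψ hψ2)
  have hK : 0 ≤ 2 / r + C * r / 2 := by positivity
  rw [(hasFDerivAt_negMulLog_comp hf hC h0 hψ2).fderiv, norm_smul]
  have hg := norm_fderiv_le_sqrt hf hC hr h0 h1 hψ
  have ha1 : √(f ψ) ≤ 1 := Real.sqrt_le_one.2 (h1 ψ hψ2)
  have hlog : ‖-(1 + Real.log (f ψ))‖ * √(f ψ) ≤ 3 := by
    rcases (h0 ψ hψ2).eq_or_lt with hz | hpos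
    · simp [← hz]
    have hapos : 0 < √(f ψ) := Real.sqrt_pos.2 hpos
    have hl := Real.one_sub_inv_le_log_of_pos hapos
    rw [Real.log_sqrt (h0 ψ hψ2)] at hl
    have hl0 : Real.log (f ψ) ≤ 0 := Real.log_nonpos (h0 ψ hψ2) (h1 ψ hψ2)
    have hinv : (√(f ψ))⁻¹ * √(f ψ) = 1 := inv_mul_cancel₀ hapos.ne'
    have hn : ‖-(1 + Real.log (f ψ))‖ ≤ 1 + 2 * (√(f ψ))⁻¹ := by
      rw [norm_neg, Real.norm_eq_abs, abs_le]
      have : 0 < (√(f ψ))⁻¹ := inv_pos.2 hapos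
      constructor <;> linarith
    nlinarith [mul_le_mul_of_nonneg_right hn hapos.le]
  calc ‖-(1 + Real.log (f ψ))‖ * ‖fderiv ℝ f ψ‖
      ≤ ‖-(1 + Real.log (f ψ))‖ * ((2 / r + C * r / 2) * √(f ψ)) := by gcongr
    _ = (‖-(1 + Real.log (f ψ))‖ * √(f ψ)) * (2 / r + C * r / 2) := by ring
    _ ≤ 3 * (2 / r + C * r / 2) := by gcongr

end Glaeser

/-- The logarithmic derivative of a nonnegative function. Where `f` vanishes both sides are zero:
`log ∘ f` is not differentiable there, unless `f` vanishes nearby. -/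
lemma gradient_log_comp {V : Type*} [NormedAddCommGroup V] [InnerProductSpace ℝ V]
    [CompleteSpace V] {f : V → ℝ} {φ : V} (hf : DifferentiableAt ℝ f φ)
    (h0 : ∀ᶠ ψ in nhds φ, 0 ≤ f ψ) :
    gradient (fun ψ => Real.log (f ψ)) φ = (f φ)⁻¹ • gradient f φ := by
  rcases eq_or_ne (f φ) 0 with hz | hne
  · rw [hz, inv_zero, zero_smul]
    by_cases hd : DifferentiableAt ℝ (fun ψ => Real.log (f ψ)) φ
    · have h1 : ∀ᶠ ψ in nhds φ, -1 < Real.log (f ψ) :=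
        hd.continuousAt.eventually (lt_mem_nhds (by simp [hz]))
      have h2 : ∀ᶠ ψ in nhds φ, f ψ < Real.exp (-1) :=
        hf.continuousAt.eventually (gt_mem_nhds (by rw [hz]; positivity))
      have h3 : (fun ψ => Real.log (f ψ)) =ᶠ[nhds φ] fun _ => 0 := by
        filter_upwards [h0, h1, h2] with ψ h0 h1 h2
        rcases h0.eq_or_lt with h | h
        · simp [← h]
        · have := (Real.log_lt_log h h2)
          rw [Real.log_exp] at this
          linarith
      rw [Filter.EventuallyEq.gradient_eq h3]
      simp [gradient]
    · exact gradient_eq_zero_of_not_differentiableAt hd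
  · rw [gradient, fderiv.log hf hne, map_smul]
    rfl

namespace RevenueNetwork

variable {m n d : ℕ} (M : RevenueNetwork m n)

/-! ### Regular families of policies -/

/-- A family of regular policies near the parameter `φ`, with the estimates, uniform in time and
inventory, which are needed for differentiation with respect to the parameter. -/
structure IsRegularFamilyAt (π : EuclideanSpace ℝ (Fin d) → Policy m n)
    (φ : EuclideanSpace ℝ (Fin d)) (r L : ℝ) : Prop where
  r_pos : 0 < r
  L_nonneg : 0 ≤ L
  regular : ∀ ψ ∈ Metric.ball φ r, M.IsRegular (π ψ)
  differentiableAt : ∀ t x S, DifferentiableAt ℝ (fun ψ => π ψ t x S) φ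
  measurable_gradient : ∀ x S, Measurable fun t => gradient (fun ψ => π ψ t x S) φ
  norm_gradient_le : ∀ t x S, ‖gradient (fun ψ => π ψ t x S) φ‖ ≤ L * √(π φ t x S)
  abs_sub_le : ∀ ψ ∈ Metric.ball φ r, ∀ t x S, |π ψ t x S - π φ t x S| ≤ L * ‖ψ - φ‖
  abs_sub_sub_inner_le : ∀ ψ ∈ Metric.ball φ r, ∀ t x S,
    |π ψ t x S - π φ t x S - inner ℝ (gradient (fun ψ => π ψ t x S) φ) (ψ - φ)|
      ≤ L * ‖ψ - φ‖ ^ 2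
  hasGradientAt_negMulLog : ∀ t x S, HasGradientAt (fun ψ => Real.negMulLog (π ψ t x S))
    (-(1 + Real.log (π φ t x S)) • gradient (fun ψ => π ψ t x S) φ) φ
  norm_gradient_negMulLog_le : ∀ t x S,
    ‖-(1 + Real.log (π φ t x S)) • gradient (fun ψ => π ψ t x S) φ‖ ≤ L
  abs_negMulLog_sub_le : ∀ ψ ∈ Metric.ball φ r, ∀ t x S,
    |Real.negMulLog (π ψ t x S) - Real.negMulLog (π φ t x S)| ≤ L * ‖ψ - φ‖

lemma le_one_of_sum_eq_one {q : Assortment n → ℝ} (h0 : ∀ S, 0 ≤ q S) (h1 : ∑ S, q S = 1)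
    (S : Assortment n) : q S ≤ 1 :=
  h1 ▸ Finset.single_le_sum (fun S _ => h0 S) (Finset.mem_univ S)

lemma norm_gradient {V : Type*} [NormedAddCommGroup V] [InnerProductSpace ℝ V] [CompleteSpace V]
    (f : V → ℝ) (φ : V) : ‖gradient f φ‖ = ‖fderiv ℝ f φ‖ := by
  rw [gradient, LinearIsometryEquiv.norm_map]

lemma IsSmoothFamily.measurable_gradient_confine {Φ : Set (EuclideanSpace ℝ (Fin d))}
    {π : EuclideanSpace ℝ (Fin d) → Policy m n} (hsmooth : M.IsSmoothFamily Φ π)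
    {φ : EuclideanSpace ℝ (Fin d)} (hφ : φ ∈ Φ) (x : Inventory m) (S : Assortment n) :
    Measurable fun t => gradient (fun ψ => M.confine (π ψ) t x S) φ := by
  have hconst : ∀ t, ¬ (t ∈ Set.Icc 0 M.T ∧ x ≤ M.c) →
      gradient (fun ψ => M.confine (π ψ) t x S) φ = 0 := fun t h => by
    simp only [confine_of_not _ h]
    exact gradient_const _ _
  by_cases hx : x ≤ M.c
  · refine measurable_of_restrict_of_restrict_compl (s := Set.Icc 0 M.T) measurableSet_Icc ?_ ?_
    · have h := (hsmooth.gradient_continuousOn φ hφ x hx S).domRestrict.measurable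
      convert h using 1
      ext1 t
      simp only [Set.domRestrict_apply, confine_of_mem _ t.2 hx]
    · have : (Set.Icc 0 M.T)ᶜ.domRestrict
          (fun t => gradient (fun ψ => M.confine (π ψ) t x S) φ) = fun _ => 0 := by
        ext1 t
        exact hconst t fun h => t.2 h.1
      rw [this]
      exact measurable_const
  · simp only [hconst _ fun h => hx h.2]
    exact measurable_const

/-- A smooth family of admissible policies is regular near each parameter, once confined to
the relevant times and inventories. -/
lemma IsSmoothFamily.exists_isRegularFamilyAt {Φ : Set (EuclideanSpace ℝ (Fin d))}
    (hΦ : IsOpen Φ) {π : EuclideanSpace ℝ (Fin d) → Policy m n}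
    (hadm : ∀ φ ∈ Φ, M.IsAdmissible (π φ)) (hsmooth : M.IsSmoothFamily Φ π)
    {φ : EuclideanSpace ℝ (Fin d)} (hφ : φ ∈ Φ) :
    ∃ r L, M.IsRegularFamilyAt (fun ψ => M.confine (π ψ)) φ r L := by
  obtain ⟨ε, hε, hsub⟩ := Metric.nhds_basis_closedBall.mem_iff.1 (hΦ.mem_nhds hφ)
  obtain ⟨C₀, hC₀⟩ := hsmooth.hessian_bounded _ hsub (isCompact_closedBall φ ε)
  set C := max C₀ 0
  set r := ε / 2 with hrdef
  have hr : 0 < r := by positivity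
  have hC : 0 ≤ C := le_max_right _ _
  have hball : Metric.ball φ (2 * r) ⊆ Metric.closedBall φ ε := by
    rw [show 2 * r = ε by rw [hrdef]; ring]
    exact Metric.ball_subset_closedBall
  have hball' : Metric.ball φ r ⊆ Metric.ball φ (2 * r) := Metric.ball_subset_ball (by linarith)
  set K := 2 / r + C * r / 2 with hKdef
  have hK : 0 ≤ K := by positivity
  have hreg : ∀ ψ ∈ Metric.ball φ (2 * r), M.IsRegular (M.confine (π ψ)) := fun ψ hψ =>
    (hadm ψ (hsub (hball hψ))).isRegular_confine
  have hcd : ∀ t x S, ContDiffOn ℝ 2 (fun ψ => M.confine (π ψ) t x S)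
      (Metric.ball φ (2 * r)) := by
    intro t x S
    by_cases h : t ∈ Set.Icc 0 M.T ∧ x ≤ M.c
    · simp only [confine_of_mem _ h.1 h.2]
      exact ((hsmooth.smooth t h.1 x h.2 S).of_le
        (show ((2 : ℕ∞) : WithTop ℕ∞) ≤ _ from WithTop.coe_le_coe.2 le_top)).mono
        (hball.trans hsub)
    · simp only [confine_of_not _ h]
      exact contDiffOn_const
  have hH : ∀ t x S, ∀ ψ ∈ Metric.ball φ (2 * r),
      ‖iteratedFDeriv ℝ 2 (fun ψ => M.confine (π ψ) t x S) ψ‖ ≤ C := by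
    intro t x S ψ hψ
    by_cases h : t ∈ Set.Icc 0 M.T ∧ x ≤ M.c
    · simp only [confine_of_mem _ h.1 h.2]
      exact (hC₀ ψ (hball hψ) t h.1 x h.2 S).trans (le_max_left _ _)
    · simp only [confine_of_not _ h]
      rw [iteratedFDeriv_const_of_ne (by norm_num)]
      simpa using hC
  have h0 : ∀ t x S, ∀ ψ ∈ Metric.ball φ (2 * r), 0 ≤ M.confine (π ψ) t x S :=
    fun t x S ψ hψ => (hreg ψ hψ).nonneg t x S
  have h1 : ∀ t x S, ∀ ψ ∈ Metric.ball φ (2 * r), M.confine (π ψ) t x S ≤ 1 :=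
    fun t x S ψ hψ => le_one_of_sum_eq_one ((hreg ψ hψ).nonneg t x)
      ((hreg ψ hψ).sum_eq_one t x) S
  have hφr : φ ∈ Metric.ball φ r := Metric.mem_ball_self hr
  have hdiff : ∀ t x S, ∀ ψ ∈ Metric.ball φ (2 * r),
      DifferentiableAt ℝ (fun ψ => M.confine (π ψ) t x S) ψ := fun t x S ψ hψ =>
    ((hcd t x S).contDiffAt (Metric.isOpen_ball.mem_nhds hψ)).differentiableAt (by simp)
  have hgrad : ∀ t x S, ∀ ψ ∈ Metric.ball φ r,
      ‖fderiv ℝ (fun ψ => M.confine (π ψ) t x S) ψ‖ ≤ K * √(M.confine (π ψ) t x S) :=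
    fun t x S ψ hψ => norm_fderiv_le_sqrt (hcd t x S) (hH t x S) hr (h0 t x S) (h1 t x S) hψ
  have hent : ∀ t x S, HasGradientAt (fun ψ => Real.negMulLog (M.confine (π ψ) t x S))
      (-(1 + Real.log (M.confine (π φ) t x S)) • gradient (fun ψ => M.confine (π ψ) t x S) φ)
      φ := by
    intro t x S
    have h := hasFDerivAt_negMulLog_comp (hcd t x S) (hH t x S) (h0 t x S) (hball' hφr)
    rw [hasGradientAt_iff_hasFDerivAt, map_smul, toDual_gradient]
    exact h
  have hentle : ∀ t x S, ∀ ψ ∈ Metric.ball φ r,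
      ‖fderiv ℝ (fun ψ => Real.negMulLog (M.confine (π ψ) t x S)) ψ‖ ≤ 3 * K :=
    fun t x S ψ hψ => norm_fderiv_negMulLog_comp_le (hcd t x S) (hH t x S) hr (h0 t x S)
      (h1 t x S) hψ
  refine ⟨r, 3 * K + C, hr, by positivity, fun ψ hψ => hreg ψ (hball' hψ),
    fun t x S => hdiff t x S φ (hball' hφr),
    fun x S => hsmooth.measurable_gradient_confine M hφ x S, fun t x S => ?_,
    fun ψ hψ t x S => ?_, fun ψ hψ t x S => ?_, hent, fun t x S => ?_, fun ψ hψ t x S => ?_⟩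
  · rw [norm_gradient]
    refine (hgrad t x S φ hφr).trans ?_
    gcongr
    linarith
  · rw [← Real.norm_eq_abs]
    refine (convex_ball φ r).norm_image_sub_le_of_norm_fderiv_le (𝕜 := ℝ)
      (f := fun ψ => M.confine (π ψ) t x S)
      (fun y hy => hdiff t x S y (hball' hy)) (fun y hy => ?_) hφr hψ
    refine (hgrad t x S y hy).trans ?_
    have : √(M.confine (π y) t x S) ≤ 1 := Real.sqrt_le_one.2 (h1 t x S y (hball' hy))
    nlinarith
  · have h := abs_sub_sub_fderiv_le (hcd t x S) (hH t x S) (hball' hφr) (hball' hψ)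
    rw [← toDual_gradient, InnerProductSpace.toDual_apply_apply] at h
    refine h.trans ?_
    gcongr
    linarith
  · rw [← (hent t x S).gradient, norm_gradient]
    exact (hentle t x S φ hφr).trans (by linarith)
  · rw [← Real.norm_eq_abs]
    exact (convex_ball φ r).norm_image_sub_le_of_norm_fderiv_le (𝕜 := ℝ)
      (f := fun ψ => Real.negMulLog (M.confine (π ψ) t x S))
      (fun y hy => (hasFDerivAt_negMulLog_comp (hcd t x S) (hH t x S) (h0 t x S)
        (hball' hy)).differentiableAt) 
      (fun y hy => (hentle t x S y hy).trans (by linarith)) hφr hψ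

end RevenueNetwork

namespace RevenueNetwork

variable {m n : ℕ} (M : RevenueNetwork m n)

/-! ### Values of reward functionals -/

instance isProbabilityMeasure_expMeasure_rate :
    IsProbabilityMeasure (ProbabilityTheory.expMeasure M.rate) :=
  ProbabilityTheory.isProbabilityMeasure_expMeasure M.rate_pos

/-- Running rewards `h` and sale rewards `f` which are measurable in time and bounded over the
selling horizon; the bound on `f` is in the mean only, as `f` may be singular where the policy has
small probabilities. -/
structure IsBoundedReward {E : Type*} [NormedAddCommGroup E] [MeasurableSpace E] (π : Policy m n)
    (h : ℝ → Inventory m → E) (f : ℝ → Inventory m → Assortment n → Fin n → E) (B : ℝ) :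
    Prop where
  measurable_run : ∀ x, Measurable fun s => h s x
  norm_run_le : ∀ s x, ‖h s x‖ ≤ B
  run_eq_zero : ∀ s ∉ Set.Icc 0 M.T, ∀ x, h s x = 0
  measurable_sale : ∀ x S j, Measurable fun s => f s x S j
  norm_sale_le : ∀ s ∈ Set.Icc 0 M.T, ∀ x S j, π s x S * ‖f s x S j‖ ≤ B

/-- The mean total reward for the system started at time `t` with inventory `x`. -/
def value {E : Type*} [NormedAddCommGroup E] [NormedSpace ℝ E] (π : Policy m n)
    (h : ℝ → Inventory m → E) (f : ℝ → Inventory m → Assortment n → Fin n → E)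
    (t : ℝ) (x : Inventory m) : E :=
  ∫ ω, chainTotal (M.step π) (M.reward π h f) (t, x) ω ∂M.prob

/-- The mean of the reward of the next customer together with a continuation value `V`, given that
this customer arrives at time `t + z`. -/
def lookahead {E : Type*} [NormedAddCommGroup E] [NormedSpace ℝ E] (π : Policy m n)
    (h : ℝ → Inventory m → E) (f : ℝ → Inventory m → Assortment n → Fin n → E)
    (V : ℝ → Inventory m → E) (t : ℝ) (x : Inventory m) (z : ℝ) : E :=
  (∫ s in t..(t + z), h s x) + ∑ S, ∑ o, (π (t + z) x S * M.P S o) •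
    (o.elim 0 (f (t + z) x S) + V (t + z) (M.depleteBy x o))

variable {M}

lemma one_le_exp_mul_weight {t : ℝ} (ht : t ≤ M.T) :
    1 ≤ ENNReal.ofReal (Real.exp (M.rate * M.T)) * M.weight t := by
  rw [weight, ← ENNReal.ofReal_mul (by positivity), ← Real.exp_add, ENNReal.one_le_ofReal,
    Real.one_le_exp_iff]
  nlinarith [M.rate_pos]

section

variable {E : Type*} [NormedAddCommGroup E] [NormedSpace ℝ E] [MeasurableSpace E] [BorelSpace E]
  [SecondCountableTopology E] [CompleteSpace E] {π : Policy m n} (hπ : M.IsRegular π)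
  {h : ℝ → Inventory m → E} {f : ℝ → Inventory m → Assortment n → Fin n → E} {B : ℝ}
  (hb : M.IsBoundedReward π h f B)

include hb

omit [CompleteSpace E] [NormedSpace ℝ E] in
lemma IsBoundedReward.integrable_run (x : Inventory m) : Integrable fun s => h s x := by
  have h1 : IntegrableOn (fun s => h s x) (Set.Icc 0 M.T) :=
    Measure.integrableOn_of_bounded (M := B) measure_Icc_lt_top.ne
      (hb.measurable_run x).aestronglyMeasurable (.of_forall fun s => hb.norm_run_le s x)
  refine (integrableOn_iff_integrable_of_support_subset ?_).1 h1
  intro s hs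
  by_contra hcon
  exact hs (hb.run_eq_zero s hcon x)

omit [BorelSpace E] [SecondCountableTopology E] [CompleteSpace E] [NormedSpace ℝ E] in
lemma IsBoundedReward.bound_nonneg : 0 ≤ B := (norm_nonneg _).trans (hb.norm_run_le 0 0)

omit [BorelSpace E] [SecondCountableTopology E] [CompleteSpace E] in
lemma IsBoundedReward.enorm_integral_run_le (t : ℝ) (x : Inventory m) {z : ℝ} (hz : 0 ≤ z) :
    ‖∫ s in t..(t + z), h s x‖ₑ
      ≤ ENNReal.ofReal (B * M.T) * ENNReal.ofReal (Real.exp (M.rate * M.T)) * M.weight t := by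
  have hle : t ≤ t + z := by linarith
  rw [intervalIntegral.integral_of_le hle]
  rcases le_or_gt t M.T with ht | ht
  · calc ‖∫ s in Set.Ioc t (t + z), h s x‖ₑ
        ≤ ∫⁻ s in Set.Ioc t (t + z), ‖h s x‖ₑ := enorm_integral_le_lintegral_enorm _
      _ ≤ ∫⁻ s, ‖h s x‖ₑ := setLIntegral_le_lintegral _ _
      _ ≤ ∫⁻ s, (Set.Icc 0 M.T).indicator (fun _ => ENNReal.ofReal B) s := by
          refine lintegral_mono fun s => ?_
          by_cases hs : s ∈ Set.Icc 0 M.T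
          · rw [Set.indicator_of_mem hs, ← ofReal_norm]
            exact ENNReal.ofReal_le_ofReal (hb.norm_run_le s x)
          · simp [hb.run_eq_zero s hs x]
      _ = ENNReal.ofReal (B * M.T) * 1 := by
          rw [lintegral_indicator_const measurableSet_Icc, Real.volume_Icc, sub_zero, mul_one,
            ENNReal.ofReal_mul hb.bound_nonneg]
      _ ≤ _ := by
          rw [mul_assoc]
          gcongr
          exact one_le_exp_mul_weight ht
  · have : ∫ s in Set.Ioc t (t + z), h s x = 0 := by
      refine setIntegral_eq_zero_of_forall_eq_zero fun s hs => ?_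
      exact hb.run_eq_zero s (fun h' => by linarith [h'.2, hs.1]) x
    simp [this]

include hπ

omit [SecondCountableTopology E] [CompleteSpace E] [NormedSpace ℝ E] in
lemma IsBoundedReward.lintegral_sale_le (t : ℝ) (x : Inventory m) :
    ∫⁻ z, ‖(M.purchase π (t + z.1) x z).elim 0
        (f (t + z.1) x (sample (π (t + z.1) x) z.2.1))‖ₑ ∂M.customerLaw
      ≤ (∑ _S : Assortment n, ∑ _o : Option (Fin n), ENNReal.ofReal B)
        * ENNReal.ofReal (Real.exp (M.rate * M.T)) * M.weight t := by
  set K := (∑ _S : Assortment n, ∑ _o : Option (Fin n), ENNReal.ofReal B) with hK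
  have hg : ∀ (S : Assortment n) (o : Option (Fin n)),
      Measurable fun z : ℝ => ‖o.elim 0 (f (t + z) x S)‖ₑ := by
    intro S o
    cases o with
    | none => simp
    | some j => exact ((hb.measurable_sale x S j).comp (measurable_const_add t)).enorm
  rw [hπ.lintegral_customer t x (g := fun z S o => ‖o.elim 0 (f (t + z) x S)‖ₑ) hg]
  calc ∫⁻ z, ∑ S, ∑ o, ENNReal.ofReal (π (t + z) x S * M.P S o) * ‖o.elim 0 (f (t + z) x S)‖ₑ
          ∂(ProbabilityTheory.expMeasure M.rate)
      ≤ ∫⁻ z, K * ENNReal.ofReal (Real.exp (M.rate * M.T)) * M.weight (t + z)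
          ∂(ProbabilityTheory.expMeasure M.rate) := by
        refine lintegral_mono fun z => ?_
        by_cases hs : t + z ∈ Set.Icc 0 M.T
        · calc _ ≤ K * 1 := by
                rw [mul_one, hK]
                refine Finset.sum_le_sum fun S _ => Finset.sum_le_sum fun o _ => ?_
                cases o with
                | none => simp
                | some j =>
                  rw [Option.elim_some, ← ofReal_norm, ← ENNReal.ofReal_mul
                    (mul_nonneg (hπ.nonneg _ _ _) (M.P_nonneg _ _))]
                  refine ENNReal.ofReal_le_ofReal ?_
                  have h1 := hb.norm_sale_le _ hs x S j
                  have h2 := M.P_le_one S (some j)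
                  have h3 := mul_nonneg (hπ.nonneg (t + z) x S) (norm_nonneg (f (t + z) x S j))
                  nlinarith
            _ ≤ _ := by
                rw [mul_assoc]
                gcongr
                exact one_le_exp_mul_weight hs.2
        · refine le_of_eq_of_le (Finset.sum_eq_zero fun S _ => Finset.sum_eq_zero fun o _ => ?_)
            bot_le
          rw [hπ.idle _ _ fun h' => hs h'.1]
          split_ifs with hS
          · subst hS
            cases o <;> simp [M.P_empty]
          · simp
    _ ≤ _ := by
        rw [lintegral_const_mul' _ _ (ENNReal.mul_ne_top (by simp [hK, ENNReal.mul_eq_top])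
          (by simp)), M.lintegral_weight_add]
        gcongr
        exact mul_le_of_le_one_left' (by simp)

omit [CompleteSpace E] [SecondCountableTopology E] in
/-- The mean reward between successive customers is bounded by a multiple of the weight. -/
lemma IsBoundedReward.exists_lintegral_reward_le : ∃ C : ℝ≥0∞, C ≠ ⊤ ∧ ∀ y : ℝ × Inventory m,
    ∫⁻ z, ‖M.reward π h f y z‖ₑ ∂M.customerLaw ≤ C * M.weight y.1 := by
  refine ⟨ENNReal.ofReal (B * M.T) * ENNReal.ofReal (Real.exp (M.rate * M.T))
    + (∑ _S : Assortment n, ∑ _o : Option (Fin n), ENNReal.ofReal B)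
      * ENNReal.ofReal (Real.exp (M.rate * M.T)), ?_, fun y => ?_⟩
  · simp [ENNReal.mul_eq_top]
  · calc ∫⁻ z, ‖M.reward π h f y z‖ₑ ∂M.customerLaw
        ≤ ∫⁻ z, (ENNReal.ofReal (B * M.T) * ENNReal.ofReal (Real.exp (M.rate * M.T))
              * M.weight y.1 + ‖(M.purchase π (y.1 + z.1) y.2 z).elim 0
              (f (y.1 + z.1) y.2 (sample (π (y.1 + z.1) y.2) z.2.1))‖ₑ) ∂M.customerLaw := by
          refine lintegral_mono_ae ?_
          filter_upwards [M.ae_customer_pos] with z hz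
          refine (enorm_add_le _ _).trans ?_
          gcongr
          exact hb.enorm_integral_run_le y.1 y.2 hz.le
      _ ≤ _ := by
          rw [lintegral_add_left measurable_const, lintegral_const, measure_univ, mul_one]
          exact add_le_add le_rfl (hb.lintegral_sale_le hπ y.1 y.2)
      _ = _ := (add_mul _ _ _).symm

lemma IsBoundedReward.integrable_chainTotal (y : ℝ × Inventory m) :
    Integrable (chainTotal (M.step π) (M.reward π h f) y) M.prob := by
  obtain ⟨C, hC, hle⟩ := hb.exists_lintegral_reward_le hπ
  exact _root_.integrable_chainTotal M.customerLaw hπ.measurable_step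
    (w := fun y => M.weight y.1) (fun y => M.weight_ne_top y.1) (M.lintegral_weight_step π)
    (hπ.stronglyMeasurable_reward hb.integrable_run hb.measurable_sale) hC hle y

omit [CompleteSpace E] in
lemma IsBoundedReward.stronglyMeasurable_value :
    StronglyMeasurable fun y : ℝ × Inventory m => M.value π h f y.1 y.2 := by
  obtain ⟨C, hC, hle⟩ := hb.exists_lintegral_reward_le hπ
  exact stronglyMeasurable_integral_chainTotal M.customerLaw hπ.measurable_step
    (w := fun y => M.weight y.1) (fun y => M.weight_ne_top y.1) (M.lintegral_weight_step π)
    (hπ.stronglyMeasurable_reward hb.integrable_run hb.measurable_sale) hC hle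

omit [CompleteSpace E] in
lemma IsBoundedReward.measurable_value (x : Inventory m) :
    Measurable fun t => M.value π h f t x :=
  (hb.stronglyMeasurable_value hπ).measurable.comp measurable_prodMk_right

omit [CompleteSpace E] in
lemma IsBoundedReward.exists_norm_value_le : ∃ C : ℝ, 0 ≤ C ∧ ∀ t x,
    ‖M.value π h f t x‖ ≤ C * Real.exp (-(M.rate * t)) := by
  obtain ⟨C, hC, hle⟩ := hb.exists_lintegral_reward_le hπ
  refine ⟨(2 * C).toReal, ENNReal.toReal_nonneg, fun t x => ?_⟩
  have h1 := enorm_integral_chainTotal_le M.customerLaw hπ.measurable_step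
    (w := fun y => M.weight y.1) (M.lintegral_weight_step π)
    (hπ.stronglyMeasurable_reward hb.integrable_run hb.measurable_sale) hC hle (t, x)
  have h2 := ENNReal.toReal_mono
    (ENNReal.mul_ne_top (ENNReal.mul_ne_top (by simp) hC) (M.weight_ne_top t)) h1
  rwa [toReal_enorm, ENNReal.toReal_mul, weight, ENNReal.toReal_ofReal (by positivity)] at h2

/-- Renewal equation: the value is the mean of the lookahead over the next arrival time. -/
lemma IsBoundedReward.value_eq (t : ℝ) (x : Inventory m) :
    Integrable (M.lookahead π h f (M.value π h f) t x) (ProbabilityTheory.expMeasure M.rate) ∧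
    M.value π h f t x
      = ∫ z, M.lookahead π h f (M.value π h f) t x z
          ∂(ProbabilityTheory.expMeasure M.rate) := by
  obtain ⟨C, hC, hle⟩ := hb.exists_lintegral_reward_le hπ
  have hrew := hπ.stronglyMeasurable_reward hb.integrable_run hb.measurable_sale
  have h1 := integral_chainTotal_eq M.customerLaw hπ.measurable_step
    (w := fun y => M.weight y.1) (fun y => M.weight_ne_top y.1) (M.lintegral_weight_step π)
    hrew hC hle (t, x)
  have hint1 : Integrable (fun z => M.reward π h f (t, x) z) M.customerLaw :=
    ⟨(hrew.comp_measurable measurable_prodMk_left).aestronglyMeasurable,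
      lt_of_le_of_lt (hle (t, x)) (ENNReal.mul_ne_top hC (M.weight_ne_top t)).lt_top⟩
  have hint2 : Integrable (fun z => M.value π h f (M.step π (t, x) z).1 (M.step π (t, x) z).2)
      M.customerLaw := by
    refine ⟨((hb.stronglyMeasurable_value hπ).comp_measurable
      (hπ.measurable_step.comp measurable_prodMk_left)).aestronglyMeasurable, ?_⟩
    calc _ ≤ ∫⁻ z, 2 * C * M.weight (M.step π (t, x) z).1 ∂M.customerLaw :=
          lintegral_mono fun z => enorm_integral_chainTotal_le M.customerLaw hπ.measurable_step
            (w := fun y => M.weight y.1) (M.lintegral_weight_step π) hrew hC hle _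
      _ ≤ 2 * C * (2⁻¹ * M.weight t) := by
          rw [lintegral_const_mul' _ _ (ENNReal.mul_ne_top (by simp) hC)]
          gcongr
          exact M.lintegral_weight_step π (t, x)
      _ < ⊤ := (ENNReal.mul_ne_top (ENNReal.mul_ne_top (by simp) hC)
          (ENNReal.mul_ne_top (by simp) (M.weight_ne_top t))).lt_top
  set g : ℝ → Assortment n → Option (Fin n) → E := fun z S o =>
    (∫ s in t..(t + z), h s x) +
      (o.elim 0 (f (t + z) x S) + M.value π h f (t + z) (M.depleteBy x o)) with hg
  have hfun : (fun z : Customer =>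
      g z.1 (sample (π (t + z.1) x) z.2.1) (M.purchase π (t + z.1) x z))
      = fun z => M.reward π h f (t, x) z
        + M.value π h f (M.step π (t, x) z).1 (M.step π (t, x) z).2 := by
    ext1 z
    simp only [hg, reward, step, add_assoc]
  have hgint : Integrable (fun z : Customer =>
      g z.1 (sample (π (t + z.1) x) z.2.1) (M.purchase π (t + z.1) x z)) M.customerLaw := by
    rw [hfun]; exact hint1.add hint2
  have hlook : ∀ z, ∑ S, ∑ o, (π (t + z) x S * M.P S o) • g z S o
      = M.lookahead π h f (M.value π h f) t x z := by
    intro z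
    have hone : ∑ S, ∑ o, π (t + z) x S * M.P S o = 1 := by
      simp only [← Finset.mul_sum, M.P_sum, mul_one, hπ.sum_eq_one]
    simp only [hg, lookahead, smul_add, Finset.sum_add_distrib, ← Finset.sum_smul]
    rw [hone, one_smul]
  constructor
  · have h2 : Integrable (fun z => ∫ u, g z (sample (π (t + z) x) u.1)
        (M.purchase π (t + z) x (z, u)) ∂(uniform01.prod uniform01))
        (ProbabilityTheory.expMeasure M.rate) := by
      rw [customerLaw] at hgint
      exact hgint.integral_prod_left
    simp only [hπ.integral_choice, hlook] at h2
    exact h2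
  · have h3 := hπ.integral_customer t x hgint
    simp only [hlook] at h3
    rw [← h3, hfun]
    exact h1

end

end RevenueNetwork

namespace RevenueNetwork

variable {m n d : ℕ} {M : RevenueNetwork m n}

/-! ### The value function and the gradient functional as values -/

lemma entropy_eq_sum_negMulLog (π : Policy m n) (t : ℝ) (x : Inventory m) :
    M.entropy π t x = ∑ S ∈ M.available x, Real.negMulLog (π t x S) := by
  simp [entropy, Real.negMulLog, Finset.sum_neg_distrib]

/-- The revenue of a purchase. -/
def price (M : RevenueNetwork m n) (o : Option (Fin n)) : ℝ := o.elim 0 M.p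

lemma abs_price_le (o : Option (Fin n)) : |M.price o| ≤ ∑ j, |M.p j| := by
  cases o with
  | none => simpa [price] using Finset.sum_nonneg fun j _ => abs_nonneg (M.p j)
  | some j =>
    exact Finset.single_le_sum (f := fun j => |M.p j|) (fun j _ => abs_nonneg _)
      (Finset.mem_univ j)

section

variable {π : Policy m n} (hπ : M.IsRegular π)

include hπ

lemma IsRegular.le_one (t : ℝ) (x : Inventory m) (S : Assortment n) : π t x S ≤ 1 :=
  le_one_of_sum_eq_one (hπ.nonneg t x) (hπ.sum_eq_one t x) S

lemma IsRegular.entropy_eq_zero {t : ℝ} (x : Inventory m) (ht : t ∉ Set.Icc 0 M.T) :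
    M.entropy π t x = 0 := by
  rw [entropy_eq_sum_negMulLog]
  refine Finset.sum_eq_zero fun S _ => ?_
  rw [hπ.idle t x fun h => ht h.1]
  split_ifs <;> simp

lemma IsRegular.abs_entropy_le (t : ℝ) (x : Inventory m) :
    |M.entropy π t x| ≤ Fintype.card (Assortment n) := by
  rw [entropy_eq_sum_negMulLog]
  refine (Finset.abs_sum_le_sum_abs _ _).trans ?_
  calc ∑ S ∈ M.available x, |Real.negMulLog (π t x S)|
      ≤ ∑ _S ∈ M.available x, (1 : ℝ) := by
        refine Finset.sum_le_sum fun S _ => ?_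
        have h0 := hπ.nonneg t x S
        have h1 := hπ.le_one t x S
        rw [abs_of_nonneg (Real.negMulLog_nonneg h0 h1)]
        have h2 := Real.negMulLog_le_one_sub_self h0
        linarith
    _ ≤ Fintype.card (Assortment n) := by
        rw [Finset.sum_const, nsmul_eq_mul, mul_one]
        exact_mod_cast Finset.card_le_univ _

lemma IsRegular.measurable_entropy (x : Inventory m) :
    Measurable fun t => M.entropy π t x := by
  simp only [entropy_eq_sum_negMulLog]
  exact Finset.measurable_fun_sum _ fun S _ =>
    Real.continuous_negMulLog.measurable.comp (hπ.measurable x S)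

lemma IsRegular.exists_isBoundedReward :
    ∃ B, M.IsBoundedReward π (fun s x => M.γ * M.entropy π s x) (fun _ _ _ j => M.p j) B := by
  refine ⟨M.γ * Fintype.card (Assortment n) + ∑ j, |M.p j|,
    fun x => (hπ.measurable_entropy x).const_mul _, fun s x => ?_,
    fun s hs x => by rw [hπ.entropy_eq_zero x hs, mul_zero], fun _ _ _ => measurable_const,
    fun s _ x S j => ?_⟩
  · rw [norm_mul, Real.norm_of_nonneg M.γ_nonneg, Real.norm_eq_abs]
    have h1 := mul_le_mul_of_nonneg_left (hπ.abs_entropy_le s x) M.γ_nonneg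
    have h2 := Finset.sum_nonneg fun (j : Fin n) (_ : j ∈ Finset.univ) => abs_nonneg (M.p j)
    linarith
  · have h1 := hπ.nonneg s x S
    have h2 := hπ.le_one s x S
    have h3 : ‖M.p j‖ ≤ ∑ j, |M.p j| := abs_price_le (some j)
    have h4 : 0 ≤ M.γ * Fintype.card (Assortment n) := mul_nonneg M.γ_nonneg (by positivity)
    nlinarith [norm_nonneg (M.p j)]

lemma IsRegular.J_eq_value (t : ℝ) (x : Inventory m) :
    M.J π t x = M.value π (fun s x => M.γ * M.entropy π s x) (fun _ _ _ j => M.p j) t x := by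
  obtain ⟨B, hb⟩ := hπ.exists_isBoundedReward
  refine integral_congr_ae ?_
  filter_upwards [M.ae_isGood] with ω hω
  rw [← hω.rewards_eq_chainTotal hb.integrable_run
    (fun s x hs => hb.run_eq_zero s (fun h => not_le.2 hs h.2) x), payoff,
    intervalIntegral.integral_const_mul]

lemma IsRegular.measurable_J (x : Inventory m) : Measurable fun t => M.J π t x := by
  obtain ⟨B, hb⟩ := hπ.exists_isBoundedReward
  simp only [hπ.J_eq_value]
  exact hb.measurable_value hπ x

lemma IsRegular.exists_abs_J_le :
    ∃ C : ℝ, 0 ≤ C ∧ ∀ t x, |M.J π t x| ≤ C * Real.exp (-(M.rate * t)) := by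
  obtain ⟨B, hb⟩ := hπ.exists_isBoundedReward
  simp only [hπ.J_eq_value, ← Real.norm_eq_abs]
  exact hb.exists_norm_value_le hπ

/-- Renewal equation of the value function. -/
lemma IsRegular.J_eq (t : ℝ) (x : Inventory m) :
    let I : ℝ → ℝ := fun z => (∫ s in t..(t + z), M.γ * M.entropy π s x) +
      ∑ S, ∑ o, (π (t + z) x S * M.P S o) *
        (M.price o + M.J π (t + z) (M.depleteBy x o))
    Integrable I (ProbabilityTheory.expMeasure M.rate) ∧
      M.J π t x = ∫ z, I z ∂(ProbabilityTheory.expMeasure M.rate) := by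
  obtain ⟨B, hb⟩ := hπ.exists_isBoundedReward
  have h := hb.value_eq hπ t x
  simp only [hπ.J_eq_value]
  exact h

end

/-- For times after `0` the exponential weight is at most one. -/
lemma exp_neg_rate_le_one {s : ℝ} (hs : 0 ≤ s) : Real.exp (-(M.rate * s)) ≤ 1 :=
  Real.exp_le_one_iff.2 (by have := mul_nonneg M.rate_pos.le hs; linarith)

section

variable {π : EuclideanSpace ℝ (Fin d) → Policy m n} {φ : EuclideanSpace ℝ (Fin d)} {r L : ℝ}
  (hF : M.IsRegularFamilyAt π φ r L)

include hF

lemma IsRegularFamilyAt.regular_self : M.IsRegular (π φ) :=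
  hF.regular φ (Metric.mem_ball_self hF.r_pos)

lemma IsRegularFamilyAt.eventually_regular : ∀ᶠ ψ in nhds φ, M.IsRegular (π ψ) := by
  filter_upwards [Metric.ball_mem_nhds φ hF.r_pos] with ψ hψ using hF.regular ψ hψ

lemma IsRegularFamilyAt.gradient_eq_zero {t : ℝ} {x : Inventory m}
    (h : ¬ (t ∈ Set.Icc 0 M.T ∧ x ≤ M.c)) (S : Assortment n) :
    gradient (fun ψ => π ψ t x S) φ = 0 := by
  have h1 : (fun ψ => π ψ t x S) =ᶠ[nhds φ] fun _ => if S = ∅ then 1 else 0 := by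
    filter_upwards [hF.eventually_regular] with ψ hψ using hψ.idle t x h S
  rw [h1.gradient_eq]
  exact gradient_const _ _

lemma IsRegularFamilyAt.sum_gradient (t : ℝ) (x : Inventory m) :
    ∑ S, gradient (fun ψ => π ψ t x S) φ = 0 := by
  have h1 : HasFDerivAt (fun ψ => ∑ S, π ψ t x S)
      (∑ S, fderiv ℝ (fun ψ => π ψ t x S) φ) φ :=
    HasFDerivAt.fun_sum fun S _ => (hF.differentiableAt t x S).hasFDerivAt
  have h2 : (fun ψ => ∑ S, π ψ t x S) =ᶠ[nhds φ] fun _ => (1 : ℝ) := by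
    filter_upwards [hF.eventually_regular] with ψ hψ using hψ.sum_eq_one t x
  have h3 := h1.unique ((hasFDerivAt_const (1 : ℝ) φ).congr_of_eventuallyEq h2)
  simp only [gradient, ← map_sum, h3, map_zero]

lemma IsRegularFamilyAt.hasGradientAt_entropy (t : ℝ) (x : Inventory m) :
    HasGradientAt (fun ψ => M.entropy (π ψ) t x)
      (∑ S ∈ M.available x,
        -(1 + Real.log (π φ t x S)) • gradient (fun ψ => π ψ t x S) φ) φ := by
  simp only [entropy_eq_sum_negMulLog]
  rw [hasGradientAt_iff_hasFDerivAt, map_sum]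
  exact HasFDerivAt.fun_sum fun S _ => hF.hasGradientAt_negMulLog t x S

lemma IsRegularFamilyAt.norm_gradient_entropy_le (t : ℝ) (x : Inventory m) :
    ‖gradient (fun ψ => M.entropy (π ψ) t x) φ‖ ≤ Fintype.card (Assortment n) * L := by
  rw [(hF.hasGradientAt_entropy t x).gradient]
  refine (norm_sum_le_of_le _ fun S _ => hF.norm_gradient_negMulLog_le t x S).trans ?_
  rw [Finset.sum_const, nsmul_eq_mul]
  have := hF.L_nonneg
  gcongr
  exact Finset.card_le_univ _

lemma IsRegularFamilyAt.measurable_gradient_entropy (x : Inventory m) :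
    Measurable fun t => gradient (fun ψ => M.entropy (π ψ) t x) φ := by
  simp only [fun t => (hF.hasGradientAt_entropy t x).gradient]
  refine Finset.measurable_fun_sum _ fun S _ => ?_
  have h : Measurable fun t => -(1 + Real.log (π φ t x S)) :=
    ((Real.measurable_log.comp (hF.regular_self.measurable x S)).const_add 1).neg
  exact h.smul (hF.measurable_gradient x S)

lemma IsRegularFamilyAt.gradient_entropy_eq_zero {t : ℝ} (x : Inventory m)
    (ht : t ∉ Set.Icc 0 M.T) : gradient (fun ψ => M.entropy (π ψ) t x) φ = 0 := by
  rw [(hF.hasGradientAt_entropy t x).gradient]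
  refine Finset.sum_eq_zero fun S _ => ?_
  rw [hF.gradient_eq_zero (fun h => ht h.1), smul_zero]

lemma IsRegularFamilyAt.abs_entropy_sub_le {ψ : EuclideanSpace ℝ (Fin d)}
    (hψ : ψ ∈ Metric.ball φ r) (t : ℝ) (x : Inventory m) :
    |M.entropy (π ψ) t x - M.entropy (π φ) t x|
      ≤ Fintype.card (Assortment n) * L * ‖ψ - φ‖ := by
  rw [entropy_eq_sum_negMulLog, entropy_eq_sum_negMulLog, ← Finset.sum_sub_distrib]
  refine (Finset.abs_sum_le_sum_abs _ _).trans ?_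
  refine (Finset.sum_le_sum fun S _ => hF.abs_negMulLog_sub_le ψ hψ t x S).trans ?_
  rw [Finset.sum_const, nsmul_eq_mul, mul_assoc]
  have := mul_nonneg hF.L_nonneg (norm_nonneg (ψ - φ))
  gcongr
  exact Finset.card_le_univ _

lemma IsRegularFamilyAt.gradient_log (t : ℝ) (x : Inventory m) (S : Assortment n) :
    gradient (fun ψ => Real.log (π ψ t x S)) φ
      = (π φ t x S)⁻¹ • gradient (fun ψ => π ψ t x S) φ :=
  gradient_log_comp (hF.differentiableAt t x S)
    (by filter_upwards [hF.eventually_regular] with ψ hψ using hψ.nonneg t x S)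

lemma IsRegularFamilyAt.smul_gradient_log (t : ℝ) (x : Inventory m) (S : Assortment n) :
    π φ t x S • gradient (fun ψ => Real.log (π ψ t x S)) φ
      = gradient (fun ψ => π ψ t x S) φ := by
  rw [hF.gradient_log]
  by_cases h : π φ t x S = 0
  · have := hF.norm_gradient_le t x S
    rw [h, Real.sqrt_zero, mul_zero] at this
    rw [norm_le_zero_iff.1 this, smul_zero, smul_zero]
  · rw [smul_inv_smul₀ h]

lemma IsRegularFamilyAt.norm_gradient_le' (t : ℝ) (x : Inventory m) (S : Assortment n) :
    ‖gradient (fun ψ => π ψ t x S) φ‖ ≤ L := by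
  refine (hF.norm_gradient_le t x S).trans (mul_le_of_le_one_right hF.L_nonneg ?_)
  exact Real.sqrt_le_one.2 (hF.regular_self.le_one t x S)

end

/-- The running part of the policy gradient. -/
def gradientRun (M : RevenueNetwork m n) (π : EuclideanSpace ℝ (Fin d) → Policy m n)
    (φ : EuclideanSpace ℝ (Fin d)) (s : ℝ) (x : Inventory m) : EuclideanSpace ℝ (Fin d) :=
  M.γ • gradient (fun ψ => M.entropy (π ψ) s x) φ

/-- The contribution of a sale to the policy gradient. -/
def gradientSale (M : RevenueNetwork m n) (π : EuclideanSpace ℝ (Fin d) → Policy m n)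
    (φ : EuclideanSpace ℝ (Fin d)) (s : ℝ) (x : Inventory m) (S : Assortment n) (j : Fin n) :
    EuclideanSpace ℝ (Fin d) :=
  (M.J (π φ) s (M.deplete x j) - M.J (π φ) s x + M.p j) •
    gradient (fun ψ => Real.log (π ψ s x S)) φ

/-- The mean of the gradient functional for the system started at time `t` with inventory `x`. -/
def gradientValue (M : RevenueNetwork m n) (π : EuclideanSpace ℝ (Fin d) → Policy m n)
    (φ : EuclideanSpace ℝ (Fin d)) : ℝ → Inventory m → EuclideanSpace ℝ (Fin d) :=
  M.value (π φ) (M.gradientRun π φ) (M.gradientSale π φ)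

section

variable {π : EuclideanSpace ℝ (Fin d) → Policy m n} {φ : EuclideanSpace ℝ (Fin d)} {r L : ℝ}
  (hF : M.IsRegularFamilyAt π φ r L)

include hF

lemma IsRegularFamilyAt.exists_isBoundedReward :
    ∃ B, M.IsBoundedReward (π φ) (M.gradientRun π φ) (M.gradientSale π φ) B := by
  have hπ := hF.regular_self
  obtain ⟨C, hC, hJ⟩ := hπ.exists_abs_J_le
  have hp := Finset.sum_nonneg fun (j : Fin n) (_ : j ∈ Finset.univ) => abs_nonneg (M.p j)
  have hL := hF.L_nonneg
  refine ⟨max (M.γ * (Fintype.card (Assortment n) * L)) ((C + C + ∑ j, |M.p j|) * L),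
    fun x => (measurable_const (a := M.γ)).smul (hF.measurable_gradient_entropy x), fun s x => ?_,
    fun s hs x => by rw [gradientRun, hF.gradient_entropy_eq_zero x hs, smul_zero],
    fun x S j => ?_, fun s hs x S j => ?_⟩
  · refine le_trans ?_ (le_max_left _ _)
    rw [gradientRun, norm_smul, Real.norm_of_nonneg M.γ_nonneg]
    exact mul_le_mul_of_nonneg_left (hF.norm_gradient_entropy_le s x) M.γ_nonneg
  · simp only [gradientSale, hF.gradient_log]
    exact (((hπ.measurable_J _).sub (hπ.measurable_J _)).add_const _).smul
      ((hπ.measurable x S).inv.smul (hF.measurable_gradient x S))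
  · refine le_trans ?_ (le_max_right _ _)
    have h1 : π φ s x S * ‖M.gradientSale π φ s x S j‖
        = |M.J (π φ) s (M.deplete x j) - M.J (π φ) s x + M.p j|
          * ‖gradient (fun ψ => π ψ s x S) φ‖ := by
      rw [gradientSale, norm_smul, mul_left_comm, ← hF.smul_gradient_log s x S, norm_smul,
        Real.norm_of_nonneg (hπ.nonneg s x S), Real.norm_eq_abs]
    have h2 : ∀ y, |M.J (π φ) s y| ≤ C := fun y =>
      (hJ s y).trans (mul_le_of_le_one_right hC (exp_neg_rate_le_one hs.1))
    rw [h1]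
    refine mul_le_mul ?_ (hF.norm_gradient_le' s x S) (norm_nonneg _) (by positivity)
    refine (abs_add_le _ _).trans (add_le_add ?_ (abs_price_le (some j)))
    exact (abs_sub _ _).trans (add_le_add (h2 _) (h2 _))

lemma IsRegularFamilyAt.gradientSample_eq_chainTotal {ω : ℕ → Customer} (hω : IsGood ω) :
    M.gradientSample π φ ω = chainTotal (M.step (π φ))
      (M.reward (π φ) (M.gradientRun π φ) (M.gradientSale π φ)) (0, M.c) ω := by
  obtain ⟨B, hb⟩ := hF.exists_isBoundedReward
  rw [← hω.rewards_eq_chainTotal hb.integrable_run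
    (fun s x hs => hb.run_eq_zero s (fun h => not_le.2 hs h.2) x), gradientSample,
    ← intervalIntegral.integral_smul]
  rfl

lemma IsRegularFamilyAt.integrable_gradientSample :
    Integrable (M.gradientSample π φ) M.prob := by
  obtain ⟨B, hb⟩ := hF.exists_isBoundedReward
  refine (hb.integrable_chainTotal hF.regular_self (0, M.c)).congr ?_
  filter_upwards [M.ae_isGood] with ω hω using (hF.gradientSample_eq_chainTotal hω).symm

lemma IsRegularFamilyAt.integral_gradientSample :
    ∫ ω, M.gradientSample π φ ω ∂M.prob = M.gradientValue π φ 0 M.c := by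
  refine integral_congr_ae ?_
  filter_upwards [M.ae_isGood] with ω hω using hF.gradientSample_eq_chainTotal hω

lemma IsRegularFamilyAt.exists_norm_gradientValue_le :
    ∃ C : ℝ, 0 ≤ C ∧ ∀ t x, ‖M.gradientValue π φ t x‖ ≤ C * Real.exp (-(M.rate * t)) := by
  obtain ⟨B, hb⟩ := hF.exists_isBoundedReward
  exact hb.exists_norm_value_le hF.regular_self

/-- In the mean, the score of the assortment offered turns the policy into its gradient; the
value before the sale drops out because the gradients sum up to zero. -/
lemma IsRegularFamilyAt.sum_gradientSale (s : ℝ) (x : Inventory m) :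
    ∑ S, ∑ o, (π φ s x S * M.P S o) • o.elim 0 (M.gradientSale π φ s x S)
      = ∑ S, ∑ o, (M.P S o * (M.price o + M.J (π φ) s (M.depleteBy x o))) •
          gradient (fun ψ => π ψ s x S) φ := by
  have h1 : ∀ S o, (π φ s x S * M.P S o) • o.elim 0 (M.gradientSale π φ s x S)
      = (M.P S o * (M.price o + M.J (π φ) s (M.depleteBy x o))) •
          gradient (fun ψ => π ψ s x S) φ
        - (M.P S o * M.J (π φ) s x) • gradient (fun ψ => π ψ s x S) φ := by
    intro S o
    rw [← sub_smul, ← hF.smul_gradient_log s x S]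
    cases o with
    | none => simp [price, depleteBy]
    | some j =>
      simp only [Option.elim_some, gradientSale, price, depleteBy, smul_smul]
      congr 1
      ring
  simp only [h1, Finset.sum_sub_distrib, ← Finset.sum_smul, ← Finset.sum_mul, M.P_sum, one_mul]
  rw [← Finset.smul_sum, hF.sum_gradient, smul_zero, sub_zero]

/-- Renewal equation of the mean of the gradient functional. -/
lemma IsRegularFamilyAt.gradientValue_eq (t : ℝ) (x : Inventory m) :
    let I : ℝ → EuclideanSpace ℝ (Fin d) := fun z =>
      (∫ s in t..(t + z), M.gradientRun π φ s x) +
      ∑ S, ∑ o, ((M.P S o * (M.price o + M.J (π φ) (t + z) (M.depleteBy x o))) •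
          gradient (fun ψ => π ψ (t + z) x S) φ
        + (π φ (t + z) x S * M.P S o) • M.gradientValue π φ (t + z) (M.depleteBy x o))
    Integrable I (ProbabilityTheory.expMeasure M.rate) ∧
      M.gradientValue π φ t x = ∫ z, I z ∂(ProbabilityTheory.expMeasure M.rate) := by
  obtain ⟨B, hb⟩ := hF.exists_isBoundedReward
  have h := hb.value_eq hF.regular_self t x
  intro I
  have hI : M.lookahead (π φ) (M.gradientRun π φ) (M.gradientSale π φ)
      (M.value (π φ) (M.gradientRun π φ) (M.gradientSale π φ)) t x = I := by
    ext1 z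
    simp only [I, lookahead, smul_add, Finset.sum_add_distrib, hF.sum_gradientSale]
    rfl
  rw [hI] at h
  exact h

end

end RevenueNetwork

namespace RevenueNetwork

variable {m n d : ℕ} {M : RevenueNetwork m n}

/-! ### Differentiation of the value function -/

lemma integral_exp_neg_rate (t : ℝ) :
    Integrable (fun z => Real.exp (-(M.rate * (t + z)))) (ProbabilityTheory.expMeasure M.rate) ∧
      ∫ z, Real.exp (-(M.rate * (t + z))) ∂(ProbabilityTheory.expMeasure M.rate)
        = Real.exp (-(M.rate * t)) / 2 := by
  have h := M.lintegral_weight_add t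
  have hm : AEStronglyMeasurable (fun z => Real.exp (-(M.rate * (t + z))))
      (ProbabilityTheory.expMeasure M.rate) :=
    (by fun_prop : Measurable fun z => Real.exp (-(M.rate * (t + z)))).aestronglyMeasurable
  have hnn : ∀ z, 0 ≤ Real.exp (-(M.rate * (t + z))) := fun z => (Real.exp_pos _).le
  constructor
  · refine ⟨hm, ?_⟩
    rw [hasFiniteIntegral_iff_ofReal (.of_forall hnn)]
    change ∫⁻ z, M.weight (t + z) ∂_ < ⊤
    rw [h]
    exact (ENNReal.mul_ne_top (by simp) (M.weight_ne_top t)).lt_top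
  · rw [integral_eq_lintegral_of_nonneg_ae (.of_forall hnn) hm]
    change (∫⁻ z, M.weight (t + z) ∂_).toReal = _
    rw [h, ENNReal.toReal_mul, weight, ENNReal.toReal_ofReal (Real.exp_pos _).le]
    simp
    ring

/-- A bound by a multiple of the weight which improves by the factor `1 / 2` up to the error `δ`
holds with the multiple `2 * δ`. -/
lemma abs_le_of_contraction {e : ℝ → Inventory m → ℝ} {δ : ℝ}
    (hstep : ∀ C, 0 ≤ C → (∀ t x, |e t x| ≤ C * Real.exp (-(M.rate * t))) →
      ∀ t x, |e t x| ≤ (δ + C / 2) * Real.exp (-(M.rate * t)))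
    {C₀ : ℝ} (hδ : 0 ≤ δ) (hC₀ : 0 ≤ C₀)
    (h₀ : ∀ t x, |e t x| ≤ C₀ * Real.exp (-(M.rate * t))) (t : ℝ) (x : Inventory m) :
    |e t x| ≤ 2 * δ * Real.exp (-(M.rate * t)) := by
  have h : ∀ k : ℕ, ∀ t x, |e t x| ≤ (2 * δ + C₀ * (1 / 2) ^ k) * Real.exp (-(M.rate * t)) := by
    intro k
    induction k with
    | zero =>
      intro t x
      refine (h₀ t x).trans ?_
      gcongr
      linarith
    | succ k ih =>
      intro t x
      refine (hstep _ (by positivity) ih t x).trans (le_of_eq ?_)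
      ring
  have hlim : Filter.Tendsto
      (fun k : ℕ => (2 * δ + C₀ * (1 / 2) ^ k) * Real.exp (-(M.rate * t))) Filter.atTop
      (nhds ((2 * δ + C₀ * 0) * Real.exp (-(M.rate * t)))) := by
    have := tendsto_pow_atTop_nhds_zero_of_lt_one (r := (1 / 2 : ℝ)) (by norm_num) (by norm_num)
    exact ((this.const_mul C₀).const_add _).mul_const _
  rw [mul_zero, add_zero] at hlim
  exact ge_of_tendsto' hlim fun k => h k t x

/-- The first order remainder of the running reward at the parameter `ψ`. -/
def entropyRemainder (M : RevenueNetwork m n) (π : EuclideanSpace ℝ (Fin d) → Policy m n)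
    (φ ψ : EuclideanSpace ℝ (Fin d)) (x : Inventory m) (s : ℝ) : ℝ :=
  M.γ * M.entropy (π ψ) s x - M.γ * M.entropy (π φ) s x
    - inner ℝ (M.gradientRun π φ s x) (ψ - φ)

section

variable {π : EuclideanSpace ℝ (Fin d) → Policy m n} {φ : EuclideanSpace ℝ (Fin d)} {r L : ℝ}
  (hF : M.IsRegularFamilyAt π φ r L)

include hF

lemma IsRegularFamilyAt.entropyRemainder_eq_zero {ψ : EuclideanSpace ℝ (Fin d)}
    (hψ : ψ ∈ Metric.ball φ r) (x : Inventory m) {s : ℝ} (hs : s ∉ Set.Icc 0 M.T) :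
    M.entropyRemainder π φ ψ x s = 0 := by
  simp [entropyRemainder, gradientRun, (hF.regular ψ hψ).entropy_eq_zero x hs,
    hF.regular_self.entropy_eq_zero x hs, hF.gradient_entropy_eq_zero x hs]

lemma IsRegularFamilyAt.entropyRemainder_eq_zero_of_not_le {ψ : EuclideanSpace ℝ (Fin d)}
    (hψ : ψ ∈ Metric.ball φ r) {x : Inventory m} (hx : ¬ x ≤ M.c) (s : ℝ) :
    M.entropyRemainder π φ ψ x s = 0 := by
  have h : ∀ ψ ∈ Metric.ball φ r, M.entropy (π ψ) s x = 0 := fun ψ hψ => by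
    rw [entropy_eq_sum_negMulLog]
    refine Finset.sum_eq_zero fun S _ => ?_
    rw [(hF.regular ψ hψ).idle s x fun h => hx h.2]
    split_ifs <;> simp
  have hg : gradient (fun ψ => M.entropy (π ψ) s x) φ = 0 := by
    rw [(hF.hasGradientAt_entropy s x).gradient]
    refine Finset.sum_eq_zero fun S _ => ?_
    rw [hF.gradient_eq_zero (fun h => hx h.2), smul_zero]
  simp [entropyRemainder, gradientRun, h ψ hψ, h φ (Metric.mem_ball_self hF.r_pos), hg]

lemma IsRegularFamilyAt.measurable_entropyRemainder {ψ : EuclideanSpace ℝ (Fin d)}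
    (hψ : ψ ∈ Metric.ball φ r) (x : Inventory m) :
    Measurable (M.entropyRemainder π φ ψ x) := by
  obtain ⟨B, hb⟩ := hF.exists_isBoundedReward
  refine Measurable.sub ?_ ((hb.measurable_run x).inner_const)
  exact (((hF.regular ψ hψ).measurable_entropy x).const_mul _).sub
    ((hF.regular_self.measurable_entropy x).const_mul _)

lemma IsRegularFamilyAt.abs_entropyRemainder_le {ψ : EuclideanSpace ℝ (Fin d)}
    (hψ : ψ ∈ Metric.ball φ r) (x : Inventory m) (s : ℝ) :
    |M.entropyRemainder π φ ψ x s|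
      ≤ 2 * (M.γ * (Fintype.card (Assortment n) * L)) * ‖ψ - φ‖ := by
  rw [entropyRemainder, ← mul_sub]
  have h1 : |M.γ * (M.entropy (π ψ) s x - M.entropy (π φ) s x)|
      ≤ M.γ * (Fintype.card (Assortment n) * L * ‖ψ - φ‖) := by
    rw [abs_mul, abs_of_nonneg M.γ_nonneg]
    exact mul_le_mul_of_nonneg_left (hF.abs_entropy_sub_le hψ s x) M.γ_nonneg
  have h2 : |inner ℝ (M.gradientRun π φ s x) (ψ - φ)|
      ≤ M.γ * (Fintype.card (Assortment n) * L) * ‖ψ - φ‖ := by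
    refine (abs_real_inner_le_norm _ _).trans ?_
    gcongr
    rw [gradientRun, norm_smul, Real.norm_of_nonneg M.γ_nonneg]
    exact mul_le_mul_of_nonneg_left (hF.norm_gradient_entropy_le s x) M.γ_nonneg
  refine (abs_sub _ _).trans ((add_le_add h1 h2).trans (le_of_eq ?_))
  ring

lemma IsRegularFamilyAt.integrable_entropyRemainder {ψ : EuclideanSpace ℝ (Fin d)}
    (hψ : ψ ∈ Metric.ball φ r) (x : Inventory m) :
    Integrable (M.entropyRemainder π φ ψ x) := by
  have h1 : IntegrableOn (M.entropyRemainder π φ ψ x) (Set.Icc 0 M.T) :=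
    Measure.integrableOn_of_bounded measure_Icc_lt_top.ne
      (hF.measurable_entropyRemainder hψ x).aestronglyMeasurable
      (.of_forall fun s => hF.abs_entropyRemainder_le hψ x s)
  refine (integrableOn_iff_integrable_of_support_subset ?_).1 h1
  intro s hs
  by_contra hcon
  exact hs (hF.entropyRemainder_eq_zero hψ x hcon)

/-- The remainder of the running reward is of smaller order in the mean over time, by dominated
convergence. -/
lemma IsRegularFamilyAt.tendsto_integral_entropyRemainder (x : Inventory m) :
    Filter.Tendsto (fun ψ => ‖ψ - φ‖⁻¹ * ∫ s, |M.entropyRemainder π φ ψ x s|)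
      (nhds φ) (nhds 0) := by
  have hball : ∀ᶠ ψ in nhds φ, ψ ∈ Metric.ball φ r := Metric.ball_mem_nhds φ hF.r_pos
  set K := 2 * (M.γ * (Fintype.card (Assortment n) * L)) with hKdef
  have hK : 0 ≤ K := by have := M.γ_nonneg; have := hF.L_nonneg; positivity
  have h := tendsto_integral_filter_of_dominated_convergence (μ := volume) (l := nhds φ)
    (F := fun ψ s => ‖ψ - φ‖⁻¹ * |M.entropyRemainder π φ ψ x s|) (f := fun _ => (0 : ℝ))
    ((Set.Icc 0 M.T).indicator fun _ => K) ?_ ?_ ?_ ?_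
  · simpa only [integral_const_mul, integral_zero] using h
  · filter_upwards [hball] with ψ hψ
    exact ((hF.measurable_entropyRemainder hψ x).norm.const_mul _).aestronglyMeasurable
  · filter_upwards [hball] with ψ hψ
    refine .of_forall fun s => ?_
    by_cases hs : s ∈ Set.Icc 0 M.T
    · rw [Set.indicator_of_mem hs, norm_mul, norm_inv, norm_norm, Real.norm_eq_abs, abs_abs]
      have h1 := hF.abs_entropyRemainder_le hψ x s
      rcases eq_or_ne (ψ - φ) 0 with hz | hz
      · simpa [hz] using hK
      · rw [inv_mul_le_iff₀ (norm_pos_iff.2 hz), mul_comm]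
        exact h1
    · simp [Set.indicator_of_notMem hs, hF.entropyRemainder_eq_zero hψ x hs]
  · exact (integrable_indicator_iff measurableSet_Icc).2 (integrableOn_const (by simp))
  · refine .of_forall fun s => ?_
    have h1 := hasGradientAt_iff_tendsto.1 (hF.hasGradientAt_entropy s x)
    rw [← (hF.hasGradientAt_entropy s x).gradient] at h1
    have h2 := h1.const_mul M.γ
    rw [mul_zero] at h2
    refine h2.congr fun ψ => ?_
    rw [Real.norm_eq_abs, entropyRemainder, gradientRun, real_inner_smul_left, ← mul_sub,
      ← mul_sub, abs_mul, abs_of_nonneg M.γ_nonneg]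
    ring

/-- The integral of the remainder between successive customers. -/
lemma IsRegularFamilyAt.abs_integral_entropyRemainder_le {ψ : EuclideanSpace ℝ (Fin d)}
    (hψ : ψ ∈ Metric.ball φ r) (t : ℝ) (x : Inventory m) {z : ℝ} (hz : 0 ≤ z) :
    |∫ s in t..(t + z), M.entropyRemainder π φ ψ x s|
      ≤ if t ≤ M.T then ∑ y ∈ Finset.Iic M.c, ∫ s, |M.entropyRemainder π φ ψ y s| else 0 := by
  have hle : t ≤ t + z := by linarith
  rw [intervalIntegral.integral_of_le hle]
  split_ifs with ht
  · have h1 : |∫ s in Set.Ioc t (t + z), M.entropyRemainder π φ ψ x s|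
        ≤ ∫ s, |M.entropyRemainder π φ ψ x s| :=
      abs_integral_le_integral_abs.trans (setIntegral_le_integral
        (hF.integrable_entropyRemainder hψ x).abs (.of_forall fun s => abs_nonneg _))
    have hnn : ∀ y ∈ Finset.Iic M.c, 0 ≤ ∫ s, |M.entropyRemainder π φ ψ y s| :=
      fun y _ => integral_nonneg fun s => abs_nonneg _
    by_cases hx : x ≤ M.c
    · exact h1.trans (Finset.single_le_sum hnn (Finset.mem_Iic.2 hx))
    · refine le_trans ?_ (Finset.sum_nonneg hnn)
      simp [hF.entropyRemainder_eq_zero_of_not_le hψ hx]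
  · rw [setIntegral_eq_zero_of_forall_eq_zero, abs_zero]
    intro s hs
    exact hF.entropyRemainder_eq_zero hψ x fun h => ht (hs.1.le.trans h.2)

/-- The first order remainder of the value function at the parameter `ψ`. -/
lemma IsRegularFamilyAt.exists_abs_J_sub_sub_inner_le : ∃ K, 0 ≤ K ∧
    ∀ ψ ∈ Metric.ball φ r, |M.J (π ψ) 0 M.c - M.J (π φ) 0 M.c
      - inner ℝ (M.gradientValue π φ 0 M.c) (ψ - φ)|
      ≤ K * ((∑ y ∈ Finset.Iic M.c, ∫ s, |M.entropyRemainder π φ ψ y s|) + ‖ψ - φ‖ ^ 2) := by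
  have hφ := hF.regular_self
  obtain ⟨CJ, hCJ, hJ⟩ := hφ.exists_abs_J_le
  obtain ⟨CG, hCG, hG⟩ := hF.exists_norm_gradientValue_le
  obtain ⟨Bg, hbg⟩ := hF.exists_isBoundedReward
  have hL := hF.L_nonneg
  set Q := ∑ j, |M.p j| with hQdef
  have hQ : 0 ≤ Q := Finset.sum_nonneg fun j _ => abs_nonneg (M.p j)
  set K₁ : ℝ := Fintype.card (Assortment n) * (L * (Q + CJ + CG)) with hK₁def
  have hK₁ : 0 ≤ K₁ := by positivity
  refine ⟨2 * (Real.exp (M.rate * M.T) * (1 + K₁)), by positivity, fun ψ hψ => ?_⟩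
  have hπψ := hF.regular ψ hψ
  set v := ψ - φ
  set α := ∑ y ∈ Finset.Iic M.c, ∫ s, |M.entropyRemainder π φ ψ y s|
  have hα0 : 0 ≤ α := Finset.sum_nonneg fun y _ => integral_nonneg fun s => abs_nonneg _
  set e : ℝ → Inventory m → ℝ := fun t x =>
    M.J (π ψ) t x - M.J (π φ) t x - inner ℝ (M.gradientValue π φ t x) v with he
  -- a crude bound from which the contraction starts
  obtain ⟨Cψ, hCψ, hJψ⟩ := hπψ.exists_abs_J_le
  have h₀ : ∀ t x, |e t x| ≤ (Cψ + CJ + CG * ‖v‖) * Real.exp (-(M.rate * t)) := by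
    intro t x
    have h1 : |inner ℝ (M.gradientValue π φ t x) v|
        ≤ CG * Real.exp (-(M.rate * t)) * ‖v‖ :=
      (abs_real_inner_le_norm _ _).trans (mul_le_mul_of_nonneg_right (hG t x) (norm_nonneg _))
    have h2 := (abs_sub (M.J (π ψ) t x - M.J (π φ) t x)
      (inner ℝ (M.gradientValue π φ t x) v)).trans
      (add_le_add ((abs_sub (M.J (π ψ) t x) (M.J (π φ) t x)).trans
        (add_le_add (hJψ t x) (hJ t x))) h1)
    refine h2.trans (le_of_eq ?_)
    ring
  -- the source terms of the equation for `e`, given the next arrival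
  have hsource : ∀ s x S o,
      |M.P S o * ((π ψ s x S - π φ s x S
          - inner ℝ (gradient (fun ψ => π ψ s x S) φ) v)
            * (M.price o + M.J (π φ) s (M.depleteBy x o))
        + (π ψ s x S - π φ s x S) * inner ℝ (M.gradientValue π φ s (M.depleteBy x o)) v)|
      ≤ if s ∈ Set.Icc 0 M.T then M.P S o * (L * (Q + CJ + CG) * ‖v‖ ^ 2) else 0 := by
    intro s x S o
    split_ifs with hs
    · rw [abs_mul, abs_of_nonneg (M.P_nonneg S o)]
      refine mul_le_mul_of_nonneg_left ?_ (M.P_nonneg S o)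
      have hw := exp_neg_rate_le_one (M := M) hs.1
      have h1 : |M.price o + M.J (π φ) s (M.depleteBy x o)| ≤ Q + CJ :=
        (abs_add_le _ _).trans (add_le_add (abs_price_le o)
          ((hJ _ _).trans (mul_le_of_le_one_right hCJ hw)))
      have h2 : |inner ℝ (M.gradientValue π φ s (M.depleteBy x o)) v| ≤ CG * ‖v‖ :=
        (abs_real_inner_le_norm _ _).trans (mul_le_mul_of_nonneg_right
          ((hG _ _).trans (mul_le_of_le_one_right hCG hw)) (norm_nonneg _))
      have h3 := hF.abs_sub_sub_inner_le ψ hψ s x S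
      have h4 := hF.abs_sub_le ψ hψ s x S
      refine (abs_add_le _ _).trans ?_
      rw [abs_mul, abs_mul]
      calc _ ≤ (L * ‖v‖ ^ 2) * (Q + CJ) + (L * ‖v‖) * (CG * ‖v‖) := by gcongr
        _ = L * (Q + CJ + CG) * ‖v‖ ^ 2 := by ring
    · rw [hπψ.idle s x (fun h => hs h.1), hφ.idle s x (fun h => hs h.1),
        hF.gradient_eq_zero (fun h => hs h.1)]
      simp
  have hstep : ∀ C, 0 ≤ C → (∀ t x, |e t x| ≤ C * Real.exp (-(M.rate * t))) →
      ∀ t x, |e t x|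
        ≤ (Real.exp (M.rate * M.T) * (α + K₁ * ‖v‖ ^ 2) + C / 2) * Real.exp (-(M.rate * t)) := by
    intro C hC hbound t x
    obtain ⟨hi1, he1⟩ := hπψ.J_eq t x
    obtain ⟨hi2, he2⟩ := hφ.J_eq t x
    obtain ⟨hi3, he3⟩ := hF.gradientValue_eq t x
    obtain ⟨hwi, hwe⟩ := integral_exp_neg_rate (M := M) t
    have heq : e t x = ∫ z, (((∫ s in t..(t + z), M.γ * M.entropy (π ψ) s x) +
          ∑ S, ∑ o, (π ψ (t + z) x S * M.P S o) *
            (M.price o + M.J (π ψ) (t + z) (M.depleteBy x o)))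
        - ((∫ s in t..(t + z), M.γ * M.entropy (π φ) s x) +
          ∑ S, ∑ o, (π φ (t + z) x S * M.P S o) *
            (M.price o + M.J (π φ) (t + z) (M.depleteBy x o)))
        - inner ℝ ((∫ s in t..(t + z), M.gradientRun π φ s x) +
          ∑ S, ∑ o, ((M.P S o * (M.price o + M.J (π φ) (t + z) (M.depleteBy x o))) •
              gradient (fun ψ => π ψ (t + z) x S) φ
            + (π φ (t + z) x S * M.P S o) •
              M.gradientValue π φ (t + z) (M.depleteBy x o))) v)
          ∂(ProbabilityTheory.expMeasure M.rate) := by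
      have hinner : ∀ f : ℝ → EuclideanSpace ℝ (Fin d),
          Integrable f (ProbabilityTheory.expMeasure M.rate) →
          inner ℝ (∫ z, f z ∂(ProbabilityTheory.expMeasure M.rate)) v
            = ∫ z, inner ℝ (f z) v ∂(ProbabilityTheory.expMeasure M.rate) := fun f hf => by
        simp only [real_inner_comm v]
        exact (integral_inner hf v).symm
      refine Eq.symm ((integral_sub (hi1.sub hi2) (hi3.inner_const v)).trans ?_)
      rw [integral_sub' hi1 hi2, ← hinner _ hi3, ← he1, ← he2, ← he3]
    have hpt : ∀ z, 0 < z → |((∫ s in t..(t + z), M.γ * M.entropy (π ψ) s x) +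
          ∑ S, ∑ o, (π ψ (t + z) x S * M.P S o) *
            (M.price o + M.J (π ψ) (t + z) (M.depleteBy x o)))
        - ((∫ s in t..(t + z), M.γ * M.entropy (π φ) s x) +
          ∑ S, ∑ o, (π φ (t + z) x S * M.P S o) *
            (M.price o + M.J (π φ) (t + z) (M.depleteBy x o)))
        - inner ℝ ((∫ s in t..(t + z), M.gradientRun π φ s x) +
          ∑ S, ∑ o, ((M.P S o * (M.price o + M.J (π φ) (t + z) (M.depleteBy x o))) •
              gradient (fun ψ => π ψ (t + z) x S) φ
            + (π φ (t + z) x S * M.P S o) •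
              M.gradientValue π φ (t + z) (M.depleteBy x o))) v|
        ≤ (if t ≤ M.T then α + K₁ * ‖v‖ ^ 2 else 0)
          + C * Real.exp (-(M.rate * (t + z))) := by
      intro z hz
      obtain ⟨B1, hb1⟩ := hπψ.exists_isBoundedReward
      obtain ⟨B2, hb2⟩ := hφ.exists_isBoundedReward
      have hrun : (∫ s in t..(t + z), M.γ * M.entropy (π ψ) s x)
          - (∫ s in t..(t + z), M.γ * M.entropy (π φ) s x)
          - inner ℝ (∫ s in t..(t + z), M.gradientRun π φ s x) v
          = ∫ s in t..(t + z), M.entropyRemainder π φ ψ x s := by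
        have hle : t ≤ t + z := by linarith
        simp only [intervalIntegral.integral_of_le hle]
        have hin : inner ℝ (∫ s in Set.Ioc t (t + z), M.gradientRun π φ s x) v
            = ∫ s in Set.Ioc t (t + z), inner ℝ (M.gradientRun π φ s x) v := by
          simp only [real_inner_comm v]
          exact (integral_inner (hbg.integrable_run x).integrableOn v).symm
        have j1 := (hb1.integrable_run x).integrableOn (s := Set.Ioc t (t + z))
        have j2 := (hb2.integrable_run x).integrableOn (s := Set.Ioc t (t + z))
        have j3 := ((hbg.integrable_run x).inner_const (𝕜 := ℝ) v).integrableOn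
          (s := Set.Ioc t (t + z))
        rw [hin]
        refine Eq.trans ?_ (integral_sub (j1.sub j2) j3).symm
        rw [integral_sub' j1 j2]
      -- the terms of the equation which contain `e` itself carry the weights of the policy at `ψ`
      have hsum : (∑ S, ∑ o, (π ψ (t + z) x S * M.P S o) *
            (M.price o + M.J (π ψ) (t + z) (M.depleteBy x o)))
          - (∑ S, ∑ o, (π φ (t + z) x S * M.P S o) *
            (M.price o + M.J (π φ) (t + z) (M.depleteBy x o)))
          - inner ℝ (∑ S, ∑ o,
            ((M.P S o * (M.price o + M.J (π φ) (t + z) (M.depleteBy x o))) •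
              gradient (fun ψ => π ψ (t + z) x S) φ
            + (π φ (t + z) x S * M.P S o) •
              M.gradientValue π φ (t + z) (M.depleteBy x o))) v
          = ∑ S, ∑ o, (M.P S o * ((π ψ (t + z) x S - π φ (t + z) x S
              - inner ℝ (gradient (fun ψ => π ψ (t + z) x S) φ) v)
                * (M.price o + M.J (π φ) (t + z) (M.depleteBy x o))
              + (π ψ (t + z) x S - π φ (t + z) x S)
                * inner ℝ (M.gradientValue π φ (t + z) (M.depleteBy x o)) v)
            + π ψ (t + z) x S * M.P S o * e (t + z) (M.depleteBy x o)) := by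
        simp only [sum_inner, ← Finset.sum_sub_distrib]
        refine Finset.sum_congr rfl fun S _ => Finset.sum_congr rfl fun o _ => ?_
        rw [inner_add_left, real_inner_smul_left, real_inner_smul_left]
        simp only [he]
        ring
      rw [inner_add_left]
      have hsplit : ∀ a b a' b' g g' : ℝ, a + b - (a' + b') - (g + g')
          = (a - a' - g) + (b - b' - g') := by intros; ring
      rw [hsplit, hrun, hsum]
      refine (abs_add_le _ _).trans ?_
      have hone : ∑ S, ∑ o, π ψ (t + z) x S * M.P S o = 1 := by
        simp only [← Finset.mul_sum, M.P_sum, mul_one, hπψ.sum_eq_one]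
      have hterm : ∀ S o, |M.P S o * ((π ψ (t + z) x S - π φ (t + z) x S
              - inner ℝ (gradient (fun ψ => π ψ (t + z) x S) φ) v)
                * (M.price o + M.J (π φ) (t + z) (M.depleteBy x o))
              + (π ψ (t + z) x S - π φ (t + z) x S)
                * inner ℝ (M.gradientValue π φ (t + z) (M.depleteBy x o)) v)
            + π ψ (t + z) x S * M.P S o * e (t + z) (M.depleteBy x o)|
          ≤ (if t ≤ M.T then M.P S o * (L * (Q + CJ + CG) * ‖v‖ ^ 2) else 0)
            + π ψ (t + z) x S * M.P S o * (C * Real.exp (-(M.rate * (t + z)))) := by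
        intro S o
        refine (abs_add_le _ _).trans (add_le_add ((hsource _ x S o).trans ?_) ?_)
        · have hnn : 0 ≤ M.P S o * (L * (Q + CJ + CG) * ‖v‖ ^ 2) :=
            mul_nonneg (M.P_nonneg S o) (by positivity)
          split_ifs with h1 h2 h2
          · exact le_rfl
          · exact absurd (by linarith [h1.2]) h2
          · exact hnn
          · exact le_rfl
        · have hnn := mul_nonneg (hπψ.nonneg (t + z) x S) (M.P_nonneg S o)
          rw [abs_mul, abs_of_nonneg hnn]
          exact mul_le_mul_of_nonneg_left (hbound _ _) hnn
      have htotal := (Finset.abs_sum_le_sum_abs (fun S => ∑ o, (M.P S o *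
              ((π ψ (t + z) x S - π φ (t + z) x S
              - inner ℝ (gradient (fun ψ => π ψ (t + z) x S) φ) v)
                * (M.price o + M.J (π φ) (t + z) (M.depleteBy x o))
              + (π ψ (t + z) x S - π φ (t + z) x S)
                * inner ℝ (M.gradientValue π φ (t + z) (M.depleteBy x o)) v)
            + π ψ (t + z) x S * M.P S o * e (t + z) (M.depleteBy x o))) Finset.univ).trans
        (Finset.sum_le_sum fun S _ => (Finset.abs_sum_le_sum_abs _ _).trans
          (Finset.sum_le_sum fun o _ => hterm S o))
      refine (add_le_add (hF.abs_integral_entropyRemainder_le hψ t x hz.le) htotal).trans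
        (le_of_eq ?_)
      simp only [Finset.sum_add_distrib, ← Finset.sum_mul, hone, one_mul]
      split_ifs with ht
      · simp only [← Finset.sum_mul, M.P_sum, one_mul, Finset.sum_const, nsmul_eq_mul,
          Finset.card_univ, hK₁def]
        ring
      · simp
    have hb : |e t x| ≤ ∫ z, ((if t ≤ M.T then α + K₁ * ‖v‖ ^ 2 else 0)
          + C * Real.exp (-(M.rate * (t + z)))) ∂(ProbabilityTheory.expMeasure M.rate) := by
      rw [heq, ← Real.norm_eq_abs]
      refine norm_integral_le_of_norm_le ((integrable_const _).add (hwi.const_mul C)) ?_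
      filter_upwards [ae_pos_expMeasure M.rate_pos] with z hz using hpt z hz
    rw [integral_add (integrable_const _) (hwi.const_mul C), integral_const_mul, hwe,
      integral_const, probReal_univ, one_smul] at hb
    refine hb.trans ?_
    have hind : (if t ≤ M.T then α + K₁ * ‖v‖ ^ 2 else 0)
        ≤ Real.exp (M.rate * M.T) * (α + K₁ * ‖v‖ ^ 2) * Real.exp (-(M.rate * t)) := by
      split_ifs with ht
      · rw [mul_right_comm (Real.exp (M.rate * M.T)), ← Real.exp_add]
        refine le_mul_of_one_le_left (by positivity) (Real.one_le_exp ?_)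
        have := mul_le_mul_of_nonneg_left ht M.rate_pos.le
        linarith
      · positivity
    rw [add_mul]
    exact add_le_add hind (le_of_eq (by ring))
  have hfin := abs_le_of_contraction hstep (by positivity) (by positivity) h₀ 0 M.c
  rw [mul_zero, neg_zero, Real.exp_zero, mul_one] at hfin
  refine hfin.trans ?_
  have : α + K₁ * ‖v‖ ^ 2 ≤ (1 + K₁) * (α + ‖v‖ ^ 2) := by
    have h1 : 0 ≤ ‖v‖ ^ 2 := by positivity
    nlinarith [mul_nonneg hK₁ hα0]
  have h2 := mul_le_mul_of_nonneg_left this (Real.exp_pos (M.rate * M.T)).le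
  linarith

lemma IsRegularFamilyAt.hasGradientAt_J :
    HasGradientAt (fun ψ => M.J (π ψ) 0 M.c) (M.gradientValue π φ 0 M.c) φ := by
  obtain ⟨K, hK, hle⟩ := hF.exists_abs_J_sub_sub_inner_le
  rw [hasGradientAt_iff_tendsto]
  have h1 : Filter.Tendsto (fun ψ => K * ((∑ y ∈ Finset.Iic M.c,
      ‖ψ - φ‖⁻¹ * ∫ s, |M.entropyRemainder π φ ψ y s|) + ‖ψ - φ‖)) (nhds φ) (nhds 0) := by
    have hn : Filter.Tendsto (fun ψ => ‖ψ - φ‖) (nhds φ) (nhds 0) :=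
      tendsto_iff_norm_sub_tendsto_zero.1 Filter.tendsto_id
    have hs := tendsto_finsetSum (Finset.Iic M.c) fun y _ =>
      hF.tendsto_integral_entropyRemainder y
    simpa using ((hs.add hn).const_mul K)
  refine squeeze_zero' (.of_forall fun ψ => by positivity) ?_ h1
  filter_upwards [Metric.ball_mem_nhds φ hF.r_pos] with ψ hψ
  rw [Real.norm_eq_abs]
  refine (mul_le_mul_of_nonneg_left (hle ψ hψ) (by positivity)).trans (le_of_eq ?_)
  rw [← Finset.mul_sum]
  rcases eq_or_ne ‖ψ - φ‖ 0 with hz | hz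
  · simp [hz]
  · field_simp

end

end RevenueNetwork

end

theorem theorem3 {m n d : ℕ} (M : RevenueNetwork m n)
    (Φ : Set (EuclideanSpace ℝ (Fin d))) (hΦ : IsOpen Φ)
    (π : EuclideanSpace ℝ (Fin d) → Policy m n)
    (hadm : ∀ φ ∈ Φ, M.IsAdmissible (π φ))
    (hsmooth : M.IsSmoothFamily Φ π)
    (φ : EuclideanSpace ℝ (Fin d)) (hφ : φ ∈ Φ) :
    Integrable (M.gradientSample π φ) M.prob ∧
      HasGradientAt (fun ψ => M.J (π ψ) 0 M.c) (∫ ω, M.gradientSample π φ ω ∂M.prob) φ := by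
  obtain ⟨r, L, hF⟩ := hsmooth.exists_isRegularFamilyAt M hΦ hadm hφ
  have hsample : M.gradientSample (fun ψ => M.confine (π ψ)) φ =ᵐ[M.prob]
      M.gradientSample π φ := by
    filter_upwards [M.ae_isGood] with ω hω using RevenueNetwork.gradientSample_confine π φ hω
  have hJ : ∀ ψ, M.J (M.confine (π ψ)) 0 M.c = M.J (π ψ) 0 M.c := fun ψ =>
    RevenueNetwork.J_confine (π ψ) ⟨le_rfl, M.T_pos.le⟩ le_rfl
  refine ⟨hF.integrable_gradientSample.congr hsample, ?_⟩
  rw [← integral_congr_ae hsample, hF.integral_gradientSample]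
  simpa only [hJ] using hF.hasGradientAt_J
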